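/- **Notation.** For an $n\times d$ matrix $Q$ with independent $N(0,1)$ entries, call $\mathcal C_0>0$ and $\mathcal C>0$ *admissible for $(n,d)$* if for all $\varepsilon\in(0,1)$ and $x\in\mathbb R^n$, $(1-\varepsilon)\|x\|^2\le\|\tfrac1{\sqrt d}Q^\top x\|^2\le(1+\varepsilon)\|x\|^2$ holds with probability at least $1-2e^{-\mathcal C_0\varepsilon^2d}$, and $\tfrac1d\|QQ^\top\|_{\rm op}\le\mathcal C\tfrac nd$ holds with probability at least $1-2e^{-d}$. Put $p(\varepsilon)=1-(2e^{-\mathcal C_0\varepsilon^2d}+2e^{-d})$. **Algorithm.** Let $n,d\ge1$, let $m\ge 2$ be even, $\beta,c\in(0,1)$, $M_1,M_2>0$. Input: $f:\mathbb R^n\to\mathbb R$, $x_0\in\mathbb R^n$, a matrix $P_{-1}\in\mathbb R^{n\times m}$ whose columns have Euclidean norm at most $1$ (for instance, are normalized), and a symmetric $H_0\in\mathbb R^{m\times m}$ with $M_1I\preceq H_0\preceq M_2I$. For $k=0,1,2,\dots$: sample $Q_k\in\mathbb R^{n\times d}$ with independent $N(0,1)$ entries, independently of $Q_0,\dots,Q_{k-1}$;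 obtain $P_k$ from $P_{k-1}$ by deleting the first two columns and appending $x_k/\|x_k\|$ and $Q_kQ_k^\top\nabla f(x_k)/\|Q_kQ_k^\top\nabla f(x_k)\|$ as the last two columns (a column whose denominator is $0$ is replaced by $0$); with $g_k(u)=f(x_k+P_ku)$, so that $\nabla g_k(u)=P_k^\top\nabla f(x_k+P_ku)$, set $u_k=-H_k\nabla g_k(0)$; let $\alpha_k=\beta^i$ for the least $i\in\{0,1,\dots\}$ with $f(x_k+\beta^iP_ku_k)\le f(x_k)+c\beta^i\nabla g_k(0)^\top u_k$; set $x_{k+1}=x_k+\alpha_kP_ku_k$; with $s=\alpha_ku_k$ and $y=\nabla g_k(\alpha_ku_k)-\nabla g_k(0)$ set $\tilde H_{k+1}=\bigl(I-\tfrac{sy^\top}{s^\top y}\bigr)H_k\bigl(I-\tfrac{ys^\top}{s^\top y}\bigr)+\tfrac{ss^\top}{s^\top y}$ (and $\tilde H_{k+1}=H_k$ if $s^\top y=0$); obtain $H_{k+1}$ from $\tilde H_{k+1}$ by replacing eigenvalues below $M_1$ by $M_1$ and eigenvalues above $M_2$ by $M_2$. **Theorem.** There are absolute constants $\mathcal C_0,\mathcal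 C>0$ that are admissible for all $(n,d)$ with $1\le d\le n$. Moreover, let $n,d\ge 1$, let $\mathcal C_0,\mathcal C$ be any constants admissible for $(n,d)$, and let $f:\mathbb R^n\to\mathbb R$ be differentiable and bounded below with optimal value $f^*=\inf f$, such that for some $L>0$, $\|\nabla f(u)-\nabla f(v)\|\le L\|u-v\|$ for all $u,v\in\mathbb R^n$, and such that for some $\sigma>0$ the Polyak–Łojasiewicz condition $\|\nabla f(x)\|^2\ge2\sigma(f(x)-f^*)$ holds for all $x\in\mathbb R^n$. Put $\bar\alpha=\min\bigl(1,\tfrac{2\beta(1-c)}{mM_2L}\bigr)$. Then for every choice of the parameters and of the input (in particular every initial point $x_0$), every $\varepsilon\in(0,1)$ and every $k\ge0$, the random variable $f(x_k)-f^*$ is integrable and $$\mathbb E[f(x_k)-f^*]\le\Bigl(1-2\sigma c\,\bar\alpha M_1\,p(\varepsilon)\Bigl(\frac{(1-\varepsilon)d}{\mathcal Cn}\Bigr)^2\Bigr)^k(f(x_0)-f^*).$$ If $p(\varepsilon)>0$, the factor that is raised to the power $k$ is less than $1$ and $\mathbb E[f(x_k)-f^*]\to0$; that is, the convergence is linear in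 expectation. -/

import Mathlib

open MeasureTheory ProbabilityTheory Filter Topology
open scoped Matrix

namespace SubspaceQN

/-- The product (entrywise) σ-algebra on real matrices. -/
instance instMeasurableSpaceMatrix {m n : Type*} : MeasurableSpace (Matrix m n ℝ) :=
  inferInstanceAs (MeasurableSpace (m → n → ℝ))

/-- The law of an `n × d` random matrix whose entries are independent `N(0,1)` variables. -/
noncomputable def gaussianMatrix (n d : ℕ) : Measure (Matrix (Fin n) (Fin d) ℝ) :=
  Measure.pi fun _ : Fin n => Measure.pi fun _ : Fin d => gaussianReal 0 1

/-- `C₀` is a norm-concentration constant in dimensions `n, d`: for every `ε ∈ (0,1)` and every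
`x`, `(1-ε)‖x‖² ≤ ‖Qᵀx/√d‖² ≤ (1+ε)‖x‖²` with probability at least `1 - 2exp(-C₀ε²d)`. -/
def IsNormConcentrationConst (n d : ℕ) (C₀ : ℝ) : Prop :=
  0 < C₀ ∧ ∀ ε : ℝ, 0 < ε → ε < 1 → ∀ x : EuclideanSpace ℝ (Fin n),
    1 - 2 * Real.exp (-(C₀ * ε ^ 2 * d)) ≤
      (gaussianMatrix n d).real {Q |
        (1 - ε) * ‖x‖ ^ 2 ≤ ‖(1 / √(d : ℝ)) • WithLp.toLp 2 (Qᵀ *ᵥ x.ofLp)‖ ^ 2 ∧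
        ‖(1 / √(d : ℝ)) • WithLp.toLp 2 (Qᵀ *ᵥ x.ofLp)‖ ^ 2 ≤ (1 + ε) * ‖x‖ ^ 2}

/-- `C` is an operator-norm constant in dimensions `n, d`: `‖QQᵀ‖ / d ≤ C n / d` with probability
at least `1 - 2exp(-d)`. -/
def IsOpNormConst (n d : ℕ) (C : ℝ) : Prop :=
  0 < C ∧
    1 - 2 * Real.exp (-(d : ℝ)) ≤
      (gaussianMatrix n d).real {Q |
        (1 / (d : ℝ)) * ‖Matrix.toEuclideanCLM (n := Fin n) (𝕜 := ℝ) (Q * Qᵀ)‖ ≤ C * (n / d)}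

/-- The probability bound `p(ε) = 1 - (2exp(-C₀ε²d) + 2exp(-d))`. -/
noncomputable def pEps (d : ℕ) (C₀ ε : ℝ) : ℝ :=
  1 - (2 * Real.exp (-(C₀ * ε ^ 2 * d)) + 2 * Real.exp (-(d : ℝ)))

/-- The step-size lower bound `ᾱ = min(1, 2β(1-c)/(m M₂ L))`. -/
noncomputable def alphaBar (m : ℕ) (β c M₂ L : ℝ) : ℝ :=
  min 1 (2 * β * (1 - c) / (m * M₂ * L))

/-- The contraction factor `1 - 2σcᾱM₁p(ε)((1-ε)d/(Cn))²`. -/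
noncomputable def rate (n d m : ℕ) (β c M₁ M₂ L σ C₀ C ε : ℝ) : ℝ :=
  1 - 2 * σ * c * alphaBar m β c M₂ L * M₁ * pEps d C₀ ε * ((1 - ε) * d / (C * n)) ^ 2

/-- `v / ‖v‖`, and `0` if `v = 0`. -/
noncomputable def normalized {n : ℕ} (v : EuclideanSpace ℝ (Fin n)) : EuclideanSpace ℝ (Fin n) :=
  ‖v‖⁻¹ • v

/-- The gradient of `f` at `x` as a coordinate vector. -/
noncomputable def grad {n : ℕ} (f : EuclideanSpace ℝ (Fin n) → ℝ) (x : EuclideanSpace ℝ (Fin n)) :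
    Fin n → ℝ :=
  (gradient f x).ofLp

/-- The first two columns of `P` are deleted, and `x/‖x‖` and `QQᵀ∇f(x)/‖QQᵀ∇f(x)‖` are appended
as the last two columns. -/
noncomputable def nextP {n d m : ℕ} (f : EuclideanSpace ℝ (Fin n) → ℝ)
    (Q : Matrix (Fin n) (Fin d) ℝ) (x : EuclideanSpace ℝ (Fin n)) (P : Matrix (Fin n) (Fin m) ℝ) :
    Matrix (Fin n) (Fin m) ℝ :=
  Matrix.of fun i j =>
    if h : j.val + 2 < m then P i ⟨j.val + 2, h⟩
    else if j.val + 2 = m then normalized x i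
    else normalized (WithLp.toLp 2 (Q *ᵥ (Qᵀ *ᵥ grad f x))) i

/-- The gradient at `u` of `g(u) = f(x + P u)`, that is, `Pᵀ∇f(x + P u)`. -/
noncomputable def subGrad {n m : ℕ} (f : EuclideanSpace ℝ (Fin n) → ℝ)
    (x : EuclideanSpace ℝ (Fin n)) (P : Matrix (Fin n) (Fin m) ℝ) (u : Fin m → ℝ) : Fin m → ℝ :=
  Pᵀ *ᵥ grad f (x + WithLp.toLp 2 (P *ᵥ u))

/-- The BFGS update of an inverse Hessian approximation. If `sᵀy = 0`, where the formula is not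
defined, the convention `1/0 = 0` makes it return `H` unchanged. -/
noncomputable def bfgs {m : ℕ} (H : Matrix (Fin m) (Fin m) ℝ) (s y : Fin m → ℝ) :
    Matrix (Fin m) (Fin m) ℝ :=
  (1 - (1 / (s ⬝ᵥ y)) • Matrix.vecMulVec s y) * H * (1 - (1 / (s ⬝ᵥ y)) • Matrix.vecMulVec y s)
    + (1 / (s ⬝ᵥ y)) • Matrix.vecMulVec s s

/-- Eigenvalues of a symmetric matrix below `M₁` are set to `M₁`, those above `M₂` to `M₂`
(through the spectral functional calculus). -/
noncomputable def modifyEig {m : ℕ} (M₁ M₂ : ℝ) (H : Matrix (Fin m) (Fin m) ℝ) :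
    Matrix (Fin m) (Fin m) ℝ :=
  cfc (fun t : ℝ => max M₁ (min M₂ t)) H

/-- The Armijo backtracking step size: `β ^ i` for the least `i` such that
`f(x + βⁱ P u) ≤ f(x) + c βⁱ (Pᵀ∇f(x))ᵀu`. -/
noncomputable def stepSize {n m : ℕ} (f : EuclideanSpace ℝ (Fin n) → ℝ) (β c : ℝ)
    (x : EuclideanSpace ℝ (Fin n)) (P : Matrix (Fin n) (Fin m) ℝ) (u : Fin m → ℝ) : ℝ :=
  β ^ sInf {i : ℕ | f (x + WithLp.toLp 2 (P *ᵥ (β ^ i • u))) ≤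
    f x + c * β ^ i * (subGrad f x P 0 ⬝ᵥ u)}

/-- The state at the beginning of an iteration: the point, the previous matrix `P`, and the
inverse Hessian approximation `H`. -/
structure State (n m : ℕ) where
  x : EuclideanSpace ℝ (Fin n)
  P : Matrix (Fin n) (Fin m) ℝ
  H : Matrix (Fin m) (Fin m) ℝ

/-- One iteration of the randomized subspace quasi-Newton method with sampled matrix `Q`. -/
noncomputable def step {n d m : ℕ} (f : EuclideanSpace ℝ (Fin n) → ℝ) (β c M₁ M₂ : ℝ)
    (Q : Matrix (Fin n) (Fin d) ℝ) (S : State n m) : State n m :=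
  let P := nextP f Q S.x S.P
  let u := -(S.H *ᵥ subGrad f S.x P 0)
  let α := stepSize f β c S.x P u
  { x := S.x + WithLp.toLp 2 (P *ᵥ (α • u))
    P := P
    H := modifyEig M₁ M₂ (bfgs S.H (α • u) (subGrad f S.x P (α • u) - subGrad f S.x P 0)) }

/-- The states of the algorithm started at `S₀` and run with the sampled matrices `Q 0, Q 1, …`. -/
noncomputable def run {n d m : ℕ} (f : EuclideanSpace ℝ (Fin n) → ℝ) (β c M₁ M₂ : ℝ)
    (S₀ : State n m) (Q : ℕ → Matrix (Fin n) (Fin d) ℝ) : ℕ → State n m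
  | 0 => S₀
  | k + 1 => step f β c M₁ M₂ (Q k) (run f β c M₁ M₂ S₀ Q k)

end SubspaceQN

/-! One iteration is deterministic once `Q` is fixed. The columns of `P` have norm at most `1`, so
`‖P u‖² ≤ m ‖u‖²`, and `0 ⪯ H ⪯ M₂ I` gives `‖H w‖² ≤ M₂ wᵀHw`. With the quadratic upper bound for
`f`, every step of size at most `2(1-c)/(m M₂ L)` passes the Armijo test, so backtracking stops at a
step of at least `ᾱ` (`stepSize_spec`). As `H ⪰ M₁ I`, `f` falls by at least `c ᾱ M₁ ‖Pᵀ∇f‖²`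
(`step_decrease`), and in particular never increases.

Write `g = ∇f(x)`. The last column of `P` alone contributes `(‖Qᵀg‖² / ‖QQᵀg‖)²` to `‖Pᵀg‖²`. If
`‖Qᵀg‖² ≥ (1-ε) d ‖g‖²` and `‖QQᵀ‖ ≤ C n`, this is at least `((1-ε)d/(Cn))² ‖g‖²`, and the
Polyak–Łojasiewicz inequality turns the decrease into a fixed portion `κ` of the gap. This good
event has probability at least `p(ε)` for each fixed `g`. Since `Q k` is independent of the current
point, Fubini gives the factor `1 - κ p(ε)` for the expected gap (`integral_gap_run_succ_le`), and
the recursion is iterated.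

The absolute constants come from Gaussian exponential moments. For a unit vector `x`, `Qᵀx` is a
standard Gaussian vector, and a Chernoff bound yields `C₀ = 1/16`. For the operator norm,
`exp(‖Qᵀv‖²/16)` is integrated over a ball of vectors `v` in place of a union bound over a net: a
large norm makes the integral large, Fubini bounds its mean, and Markov's inequality yields `C =
256`. -/

namespace SubspaceQN

/-! ### Smoothness -/

/-- The quadratic upper bound for a function with `L`-Lipschitz gradient. -/
theorem le_add_inner_gradient_add_sq {E : Type*} [NormedAddCommGroup E] [InnerProductSpace ℝ E]
    [CompleteSpace E] {f : E → ℝ} {L : ℝ} (hf : Differentiable ℝ f)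
    (hL : ∀ u v, ‖gradient f u - gradient f v‖ ≤ L * ‖u - v‖) (x v : E) :
    f (x + v) ≤ f x + inner ℝ (gradient f x) v + L / 2 * ‖v‖ ^ 2 := by
  -- The claim is `φ 1 ≤ φ 0`. For `t > 0` the derivative of `φ` is nonpositive by Cauchy–Schwarz
  -- and the Lipschitz bound.
  let φ : ℝ → ℝ := fun t =>
    f (x + t • v) - t * inner ℝ (gradient f x) v - L / 2 * t ^ 2 * ‖v‖ ^ 2
  have hφ : ∀ t, HasDerivAt φ (inner ℝ (gradient f (x + t • v)) v - inner ℝ (gradient f x) v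
      - L * t * ‖v‖ ^ 2) t := by
    intro t
    have h1 : HasDerivAt (fun t : ℝ => x + t • v) v t := by
      simpa using ((hasDerivAt_id t).smul_const v).const_add x
    have h2 : HasDerivAt (fun t : ℝ => f (x + t • v)) (inner ℝ (gradient f (x + t • v)) v) t := by
      have h := (hf (x + t • v)).hasGradientAt.hasFDerivAt.comp_hasDerivAt t h1
      exact h
    have h3 : HasDerivAt (fun t : ℝ => t * inner ℝ (gradient f x) v)
        (1 * inner ℝ (gradient f x) v) t := (hasDerivAt_id t).mul_const _
    have h4 := (((hasDerivAt_pow 2 t).const_mul (L / 2)).mul_const (‖v‖ ^ 2))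
    have h5 := (h2.sub h3).sub h4
    refine h5.congr_deriv ?_
    push_cast
    ring
  have hanti : AntitoneOn φ (Set.Ici 0) := by
    refine antitoneOn_of_deriv_nonpos (convex_Ici 0)
      (fun t _ => (hφ t).continuousAt.continuousWithinAt)
      (fun t _ => (hφ t).differentiableAt.differentiableWithinAt) ?_
    intro t ht
    rw [interior_Ici] at ht
    rw [(hφ t).deriv, ← inner_sub_left]
    have h1 := real_inner_le_norm (gradient f (x + t • v) - gradient f x) v
    have h2 := hL (x + t • v) x
    rw [add_sub_cancel_left, norm_smul, Real.norm_of_nonneg (le_of_lt ht)] at h2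
    nlinarith [norm_nonneg v, mul_le_mul_of_nonneg_right h2 (norm_nonneg v)]
  have := hanti (Set.mem_Ici.2 le_rfl) (Set.mem_Ici.2 zero_le_one) zero_le_one
  simp only [φ, one_smul, zero_smul, add_zero, one_mul, one_pow, mul_one, zero_mul, sub_zero,
    ne_eq, OfNat.ofNat_ne_zero, not_false_eq_true, zero_pow, mul_zero] at this
  linarith

theorem continuous_gradient_of_lipschitz {E : Type*} [NormedAddCommGroup E]
    [InnerProductSpace ℝ E] [CompleteSpace E] {f : E → ℝ} {L : ℝ}
    (hL : ∀ u v, ‖gradient f u - gradient f v‖ ≤ L * ‖u - v‖) : Continuous (gradient f) :=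
  (LipschitzWith.of_dist_le' fun u v => by simpa [dist_eq_norm] using hL u v).continuous

/-! ### The subspace matrix and its column norms -/

/-- The columns of `P` have Euclidean norm at most `1`. -/
def ColumnsLeOne {n m : ℕ} (P : Matrix (Fin n) (Fin m) ℝ) : Prop :=
  ∀ j, ‖WithLp.toLp 2 (fun i => P i j)‖ ≤ 1

/-- The triangle inequality over the columns, then Cauchy–Schwarz for `∑ |u j|`; this is the source
of `m` in `ᾱ`. -/
theorem ColumnsLeOne.norm_mulVec_sq_le {n m : ℕ} {P : Matrix (Fin n) (Fin m) ℝ}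
    (hP : ColumnsLeOne P) (u : Fin m → ℝ) :
    ‖WithLp.toLp 2 (P *ᵥ u)‖ ^ 2 ≤ m * (u ⬝ᵥ u) := by
  have h1 : WithLp.toLp 2 (P *ᵥ u) = ∑ j, u j • WithLp.toLp 2 (fun i => P i j) := by
    ext i
    simp [Matrix.mulVec, dotProduct, mul_comm]
  have h2 : ‖WithLp.toLp 2 (P *ᵥ u)‖ ≤ ∑ j, |u j| := by
    rw [h1]
    refine (norm_sum_le _ _).trans (Finset.sum_le_sum fun j _ => ?_)
    rw [norm_smul, Real.norm_eq_abs]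
    exact mul_le_of_le_one_right (abs_nonneg _) (hP j)
  calc ‖WithLp.toLp 2 (P *ᵥ u)‖ ^ 2 ≤ (∑ j, |u j|) ^ 2 :=
        pow_le_pow_left₀ (norm_nonneg _) h2 2
    _ ≤ (Finset.univ : Finset (Fin m)).card * ∑ j, |u j| ^ 2 := sq_sum_le_card_mul_sum_sq
    _ = m * (u ⬝ᵥ u) := by simp [dotProduct, sq]

theorem dotProduct_eq_inner {n : ℕ} (x y : EuclideanSpace ℝ (Fin n)) :
    x.ofLp ⬝ᵥ y.ofLp = inner ℝ x y := by
  simp [PiLp.inner_apply, dotProduct, mul_comm]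

theorem dotProduct_self_eq_norm_sq {m : ℕ} (v : Fin m → ℝ) :
    v ⬝ᵥ v = ‖WithLp.toLp 2 v‖ ^ 2 := by
  rw [← real_inner_self_eq_norm_sq, ← dotProduct_eq_inner]

theorem norm_normalized_le {n : ℕ} (v : EuclideanSpace ℝ (Fin n)) : ‖normalized v‖ ≤ 1 := by
  rw [normalized, norm_smul, norm_inv, norm_norm]
  exact inv_mul_le_one

theorem ColumnsLeOne.nextP {n d m : ℕ} {f : EuclideanSpace ℝ (Fin n) → ℝ}
    {P : Matrix (Fin n) (Fin m) ℝ} (hP : ColumnsLeOne P) (Q : Matrix (Fin n) (Fin d) ℝ)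
    (x : EuclideanSpace ℝ (Fin n)) : ColumnsLeOne (nextP f Q x P) := by
  intro j
  by_cases h : j.val + 2 < m
  · simpa [SubspaceQN.nextP, h] using hP ⟨j.val + 2, h⟩
  · by_cases h' : j.val + 2 = m
    · simpa [SubspaceQN.nextP, h'] using norm_normalized_le x
    · simpa [SubspaceQN.nextP, h, h'] using
        norm_normalized_le (WithLp.toLp 2 (Q *ᵥ (Qᵀ *ᵥ grad f x)))

/-! ### Spectral bounds, BFGS update and eigenvalue truncation -/

/-- `M₁ I ⪯ H ⪯ M₂ I`. -/
def SpectralBounds {m : ℕ} (M₁ M₂ : ℝ) (H : Matrix (Fin m) (Fin m) ℝ) : Prop :=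
  (H - M₁ • (1 : Matrix (Fin m) (Fin m) ℝ)).PosSemidef ∧
    (M₂ • (1 : Matrix (Fin m) (Fin m) ℝ) - H).PosSemidef

namespace SpectralBounds

variable {m : ℕ} {M₁ M₂ : ℝ} {H : Matrix (Fin m) (Fin m) ℝ}

theorem isHermitian (hH : SpectralBounds M₁ M₂ H) : H.IsHermitian := by
  have h : (M₁ • (1 : Matrix (Fin m) (Fin m) ℝ)).IsHermitian := by
    simp [Matrix.IsHermitian]
  simpa using hH.1.isHermitian.add h

theorem le_dotProduct (hH : SpectralBounds M₁ M₂ H) (w : Fin m → ℝ) :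
    M₁ * (w ⬝ᵥ w) ≤ w ⬝ᵥ (H *ᵥ w) := by
  have h := hH.1.dotProduct_mulVec_nonneg w
  simp only [star_trivial, Matrix.sub_mulVec, Matrix.smul_mulVec, Matrix.one_mulVec,
    dotProduct_sub, dotProduct_smul, smul_eq_mul] at h
  linarith

theorem dotProduct_le (hH : SpectralBounds M₁ M₂ H) (w : Fin m → ℝ) :
    w ⬝ᵥ (H *ᵥ w) ≤ M₂ * (w ⬝ᵥ w) := by
  have h := hH.2.dotProduct_mulVec_nonneg w
  simp only [star_trivial, Matrix.sub_mulVec, Matrix.smul_mulVec, Matrix.one_mulVec,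
    dotProduct_sub, dotProduct_smul, smul_eq_mul] at h
  linarith

theorem le (hm : 0 < m) (hH : SpectralBounds M₁ M₂ H) : M₁ ≤ M₂ := by
  have h1 := hH.le_dotProduct (Pi.single ⟨0, hm⟩ 1)
  have h2 := hH.dotProduct_le (Pi.single ⟨0, hm⟩ 1)
  have h3 : (Pi.single (⟨0, hm⟩ : Fin m) (1 : ℝ)) ⬝ᵥ Pi.single ⟨0, hm⟩ 1 = 1 := by simp
  rw [h3] at h1 h2
  linarith

/-- This is `H² ⪯ M₂ H`, obtained without diagonalizing: expand the nonnegative form of `H` at `H w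
- M₂ w` and bound the cubic term `(H w)ᵀH(H w)` by `M₂ ‖H w‖²`. -/
theorem dotProduct_mulVec_self_le (hM₁ : 0 < M₁) (hM₂ : 0 < M₂)
    (hH : SpectralBounds M₁ M₂ H) (w : Fin m → ℝ) :
    (H *ᵥ w) ⬝ᵥ (H *ᵥ w) ≤ M₂ * (w ⬝ᵥ (H *ᵥ w)) := by
  set v := H *ᵥ w with hv
  have hsymm : w ⬝ᵥ (H *ᵥ v) = v ⬝ᵥ v := by
    have ht : Hᵀ = H := by simpa [Matrix.IsHermitian] using hH.isHermitian
    rw [Matrix.dotProduct_mulVec, ← Matrix.mulVec_transpose, ht]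
  have h1 := hH.le_dotProduct (v - M₂ • w)
  have h2 := hH.dotProduct_le v
  have h3 : 0 ≤ M₁ * ((v - M₂ • w) ⬝ᵥ (v - M₂ • w)) :=
    mul_nonneg hM₁.le (by simpa using dotProduct_star_self_nonneg (v - M₂ • w))
  have h4 : (v - M₂ • w) ⬝ᵥ (H *ᵥ (v - M₂ • w)) =
      v ⬝ᵥ (H *ᵥ v) - 2 * M₂ * (v ⬝ᵥ v) + M₂ ^ 2 * (w ⬝ᵥ v) := by
    simp only [Matrix.mulVec_sub, Matrix.mulVec_smul, ← hv, dotProduct_sub, sub_dotProduct,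
      dotProduct_smul, smul_dotProduct, smul_eq_mul, hsymm]
    ring
  have h5 : M₂ * (v ⬝ᵥ v) ≤ M₂ * (M₂ * (w ⬝ᵥ v)) := by nlinarith
  exact le_of_mul_le_mul_left h5 hM₂

end SpectralBounds

-- Truncation restores the bounds whatever the signs of the eigenvalues, so no curvature condition
-- `sᵀy > 0` is required; symmetry is, because `cfc` takes the value `0` elsewhere.
open scoped MatrixOrder in
theorem spectralBounds_modifyEig {m : ℕ} {M₁ M₂ : ℝ} (hM : M₁ ≤ M₂)
    {H : Matrix (Fin m) (Fin m) ℝ} (hH : H.IsHermitian) :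
    SpectralBounds M₁ M₂ (modifyEig M₁ M₂ H) := by
  have hc : ContinuousOn (fun t : ℝ => max M₁ (min M₂ t)) (spectrum ℝ H) := by fun_prop
  have h1 : algebraMap ℝ _ M₁ ≤ modifyEig M₁ M₂ H :=
    algebraMap_le_cfc _ _ _ (fun x _ => le_max_left _ _) hc hH
  have h2 : modifyEig M₁ M₂ H ≤ algebraMap ℝ _ M₂ :=
    cfc_le_algebraMap _ _ _ (fun x _ => max_le hM (min_le_left _ _)) hc hH
  rw [Matrix.le_iff, Algebra.algebraMap_eq_smul_one] at h1 h2
  exact ⟨h1, h2⟩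

theorem isHermitian_bfgs {m : ℕ} {H : Matrix (Fin m) (Fin m) ℝ} (hH : H.IsHermitian)
    (s y : Fin m → ℝ) : (bfgs H s y).IsHermitian := by
  have ht : Hᵀ = H := by simpa [Matrix.IsHermitian] using hH
  simp [Matrix.IsHermitian, bfgs, Matrix.transpose_mul, Matrix.conjTranspose_eq_transpose_of_trivial,
    Matrix.transpose_sub, Matrix.transpose_vecMulVec, ht, Matrix.mul_assoc]

/-! ### Armijo backtracking -/

section Armijo

variable {n m : ℕ} {f : EuclideanSpace ℝ (Fin n) → ℝ} {L β c M₁ M₂ : ℝ}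
  {x : EuclideanSpace ℝ (Fin n)} {P : Matrix (Fin n) (Fin m) ℝ} {H : Matrix (Fin m) (Fin m) ℝ}

theorem subGrad_zero : subGrad f x P 0 = Pᵀ *ᵥ grad f x := by
  simp [subGrad]

/-- The sufficient decrease condition holds for every step of size at most
`2(1-c)/(m M₂ L)`. -/
theorem armijo_of_le (hf : Differentiable ℝ f) (hL0 : 0 < L)
    (hL : ∀ u v, ‖gradient f u - gradient f v‖ ≤ L * ‖u - v‖) (hm : 0 < m)
    (hM₁ : 0 < M₁) (hM₂ : 0 < M₂) (hP : ColumnsLeOne P) (hH : SpectralBounds M₁ M₂ H)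
    {α : ℝ} (hα0 : 0 ≤ α) (hα : α ≤ 2 * (1 - c) / (m * M₂ * L)) :
    f (x + WithLp.toLp 2 (P *ᵥ (α • -(H *ᵥ subGrad f x P 0)))) ≤
      f x + c * α * (subGrad f x P 0 ⬝ᵥ -(H *ᵥ subGrad f x P 0)) := by
  set w := subGrad f x P 0 with hw
  have h1 := le_add_inner_gradient_add_sq hf hL x
    (WithLp.toLp 2 (P *ᵥ (α • -(H *ᵥ w))))
  have h2 := hP.norm_mulVec_sq_le (α • -(H *ᵥ w))
  have h3 := hH.dotProduct_mulVec_self_le hM₁ hM₂ w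
  have h4 : inner ℝ (gradient f x) (WithLp.toLp 2 (P *ᵥ (α • -(H *ᵥ w)))) =
      -(α * (w ⬝ᵥ (H *ᵥ w))) := by
    rw [← dotProduct_eq_inner, Matrix.dotProduct_mulVec, ← Matrix.mulVec_transpose]
    change (Pᵀ *ᵥ grad f x) ⬝ᵥ _ = _
    rw [← subGrad_zero, ← hw]
    simp
  have h5 : (α • -(H *ᵥ w)) ⬝ᵥ (α • -(H *ᵥ w)) = α ^ 2 * ((H *ᵥ w) ⬝ᵥ (H *ᵥ w)) := by
    simp only [dotProduct_smul, smul_dotProduct, smul_eq_mul, dotProduct_neg, neg_dotProduct]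
    ring
  rw [h4] at h1
  rw [h5] at h2
  have hm' : (0 : ℝ) < m := by exact_mod_cast hm
  have hq : 0 ≤ w ⬝ᵥ (H *ᵥ w) := (mul_nonneg hM₁.le
    (by simpa using dotProduct_star_self_nonneg w)).trans (hH.le_dotProduct w)
  set q := w ⬝ᵥ (H *ᵥ w)
  rw [le_div_iff₀ (by positivity)] at hα
  have h6 : L / 2 * ‖WithLp.toLp 2 (P *ᵥ (α • -(H *ᵥ w)))‖ ^ 2 ≤
      L / 2 * (m * (α ^ 2 * (M₂ * q))) :=
    mul_le_mul_of_nonneg_left (h2.trans (by gcongr)) (by positivity)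
  -- This is `α m M₂ L ≤ 2(1-c)` multiplied by `α q ≥ 0`; the quadratic error is absorbed by the
  -- part `(1-c) α q` of the linear decrease.
  have h7 : L / 2 * (m * (α ^ 2 * (M₂ * q))) ≤ (1 - c) * (α * q) := by
    have := mul_le_mul_of_nonneg_right hα (mul_nonneg hα0 hq)
    nlinarith
  rw [dotProduct_neg]
  nlinarith

/-- Either the first trial `β⁰ = 1` is accepted, or the trial before the accepted one failed and
hence exceeded `2(1-c)/(m M₂ L)`; one more factor `β` gives `ᾱ`. -/
theorem stepSize_spec (hf : Differentiable ℝ f) (hL0 : 0 < L)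
    (hL : ∀ u v, ‖gradient f u - gradient f v‖ ≤ L * ‖u - v‖) (hm : 0 < m)
    (hM₁ : 0 < M₁) (hM₂ : 0 < M₂) (hβ0 : 0 < β) (hβ1 : β < 1) (hc1 : c < 1)
    (hP : ColumnsLeOne P) (hH : SpectralBounds M₁ M₂ H) :
    let u := -(H *ᵥ subGrad f x P 0)
    let α := stepSize f β c x P u
    f (x + WithLp.toLp 2 (P *ᵥ (α • u))) ≤ f x + c * α * (subGrad f x P 0 ⬝ᵥ u) ∧
      alphaBar m β c M₂ L ≤ α := by
  intro u α
  have hm' : (0 : ℝ) < m := by exact_mod_cast hm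
  set A := 2 * (1 - c) / (m * M₂ * L) with hA
  have hA0 : 0 < A := div_pos (by linarith) (by positivity)
  set S := {i : ℕ | f (x + WithLp.toLp 2 (P *ᵥ (β ^ i • u))) ≤
    f x + c * β ^ i * (subGrad f x P 0 ⬝ᵥ u)} with hS
  have key : ∀ i : ℕ, β ^ i ≤ A → i ∈ S := fun i hi =>
    armijo_of_le hf hL0 hL hm hM₁ hM₂ hP hH (by positivity) hi
  have hne : S.Nonempty := by
    obtain ⟨i, hi⟩ := exists_pow_lt_of_lt_one hA0 hβ1
    exact ⟨i, key i hi.le⟩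
  refine ⟨Nat.sInf_mem hne, ?_⟩
  have hα : α = β ^ sInf S := rfl
  rw [hα, alphaBar]
  rcases Nat.eq_zero_or_eq_succ_pred (sInf S) with h0 | h0
  · rw [h0, pow_zero]
    exact min_le_left _ _
  · refine (min_le_right _ _).trans ?_
    have h1 : (sInf S).pred ∉ S := Nat.notMem_of_lt_sInf (by omega)
    have h2 : A < β ^ (sInf S).pred := not_le.1 fun h => h1 (key _ h)
    rw [h0, pow_succ, show 2 * β * (1 - c) / (m * M₂ * L) = A * β by rw [hA]; ring]
    exact mul_le_mul_of_nonneg_right h2.le hβ0.le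

end Armijo

/-! ### Deterministic analysis of one iteration -/

section Step

variable {n d m : ℕ} {f : EuclideanSpace ℝ (Fin n) → ℝ} {L β c M₁ M₂ : ℝ}

/-- The properties of the state that every iteration preserves. -/
structure State.Valid (M₁ M₂ : ℝ) (S : State n m) : Prop where
  columns : ColumnsLeOne S.P
  bounds : SpectralBounds M₁ M₂ S.H

theorem State.Valid.step (hm : 0 < m) {S : State n m} (hS : S.Valid M₁ M₂)
    (Q : Matrix (Fin n) (Fin d) ℝ) : (step f β c M₁ M₂ Q S).Valid M₁ M₂ :=
  ⟨hS.columns.nextP Q S.x,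
    spectralBounds_modifyEig (hS.bounds.le hm) (isHermitian_bfgs hS.bounds.isHermitian _ _)⟩

theorem State.Valid.run (hm : 0 < m) {S : State n m} (hS : S.Valid M₁ M₂)
    (Q : ℕ → Matrix (Fin n) (Fin d) ℝ) (k : ℕ) : (run f β c M₁ M₂ S Q k).Valid M₁ M₂ := by
  induction k with
  | zero => exact hS
  | succ k ih => exact ih.step hm (Q k)

theorem alphaBar_pos (hL0 : 0 < L) (hm : 0 < m) (hM₂ : 0 < M₂) (hβ0 : 0 < β) (hc1 : c < 1) :
    0 < alphaBar m β c M₂ L := by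
  have hm' : (0 : ℝ) < m := by exact_mod_cast hm
  exact lt_min one_pos (div_pos (mul_pos (by positivity) (by linarith)) (by positivity))

/-- The decrease of `f` in one iteration, in terms of the projected gradient. -/
theorem step_decrease (hf : Differentiable ℝ f) (hL0 : 0 < L)
    (hL : ∀ u v, ‖gradient f u - gradient f v‖ ≤ L * ‖u - v‖) (hm : 0 < m)
    (hM₁ : 0 < M₁) (hM₂ : 0 < M₂) (hβ0 : 0 < β) (hβ1 : β < 1) (hc0 : 0 < c) (hc1 : c < 1)
    {S : State n m} (hS : S.Valid M₁ M₂) (Q : Matrix (Fin n) (Fin d) ℝ) :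
    f (step f β c M₁ M₂ Q S).x ≤ f S.x - c * alphaBar m β c M₂ L * M₁ *
      (((nextP f Q S.x S.P)ᵀ *ᵥ grad f S.x) ⬝ᵥ ((nextP f Q S.x S.P)ᵀ *ᵥ grad f S.x)) := by
  obtain ⟨h1, h2⟩ := stepSize_spec (x := S.x) hf hL0 hL hm hM₁ hM₂ hβ0 hβ1 hc1
    (hS.columns.nextP (f := f) Q S.x) hS.bounds
  have hα := alphaBar_pos hL0 hm hM₂ hβ0 hc1
  rw [← subGrad_zero]
  set w := subGrad f S.x (nextP f Q S.x S.P) 0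
  have h3 := hS.bounds.le_dotProduct w
  have h0 : 0 ≤ w ⬝ᵥ w := by simpa using dotProduct_star_self_nonneg w
  set α := stepSize f β c S.x (nextP f Q S.x S.P) (-(S.H *ᵥ w))
  have h4 : alphaBar m β c M₂ L * (M₁ * (w ⬝ᵥ w)) ≤ α * (w ⬝ᵥ (S.H *ᵥ w)) := by
    gcongr
    exact hα.le.trans h2
  have h5 : f (step f β c M₁ M₂ Q S).x ≤ f S.x + c * α * (w ⬝ᵥ -(S.H *ᵥ w)) := h1
  rw [dotProduct_neg] at h5
  nlinarith [mul_le_mul_of_nonneg_left h4 hc0.le]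

theorem step_le (hf : Differentiable ℝ f) (hL0 : 0 < L)
    (hL : ∀ u v, ‖gradient f u - gradient f v‖ ≤ L * ‖u - v‖) (hm : 0 < m)
    (hM₁ : 0 < M₁) (hM₂ : 0 < M₂) (hβ0 : 0 < β) (hβ1 : β < 1) (hc0 : 0 < c) (hc1 : c < 1)
    {S : State n m} (hS : S.Valid M₁ M₂) (Q : Matrix (Fin n) (Fin d) ℝ) :
    f (step f β c M₁ M₂ Q S).x ≤ f S.x := by
  refine (step_decrease hf hL0 hL hm hM₁ hM₂ hβ0 hβ1 hc0 hc1 hS Q).trans (sub_le_self _ ?_)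
  have := alphaBar_pos hL0 hm hM₂ hβ0 hc1
  refine mul_nonneg (by positivity) ?_
  simpa using dotProduct_star_self_nonneg ((nextP f Q S.x S.P)ᵀ *ᵥ grad f S.x)

/-- The event on which the sampled matrix `Q` gives a good direction for the vector `v`. -/
def GoodSample (n d : ℕ) (C ε : ℝ) (v : EuclideanSpace ℝ (Fin n))
    (Q : Matrix (Fin n) (Fin d) ℝ) : Prop :=
  (1 - ε) * ‖v‖ ^ 2 ≤ ‖(1 / √(d : ℝ)) • WithLp.toLp 2 (Qᵀ *ᵥ v.ofLp)‖ ^ 2 ∧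
    (1 / (d : ℝ)) * ‖Matrix.toEuclideanCLM (n := Fin n) (𝕜 := ℝ) (Q * Qᵀ)‖ ≤ C * (n / d)

theorem GoodSample.le_norm_sq {C ε : ℝ} (hd : 0 < d) {v : EuclideanSpace ℝ (Fin n)}
    {Q : Matrix (Fin n) (Fin d) ℝ} (h : GoodSample n d C ε v Q) :
    (1 - ε) * d * ‖v‖ ^ 2 ≤ ‖WithLp.toLp 2 (Qᵀ *ᵥ v.ofLp)‖ ^ 2 := by
  have hd' : (0 : ℝ) < d := by exact_mod_cast hd
  have h1 := h.1
  rw [norm_smul, mul_pow, norm_div, norm_one, Real.norm_of_nonneg (Real.sqrt_nonneg _), div_pow,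
    Real.sq_sqrt hd'.le, one_pow, one_div, ← div_eq_inv_mul, le_div_iff₀ hd'] at h1
  linarith

theorem GoodSample.norm_le {C ε : ℝ} (hd : 0 < d) {v : EuclideanSpace ℝ (Fin n)}
    {Q : Matrix (Fin n) (Fin d) ℝ} (h : GoodSample n d C ε v Q) :
    ‖WithLp.toLp 2 (Q *ᵥ (Qᵀ *ᵥ v.ofLp))‖ ≤ C * n * ‖v‖ := by
  have hd' : (0 : ℝ) < d := by exact_mod_cast hd
  have h2 := h.2
  have h3 : ‖Matrix.toEuclideanCLM (n := Fin n) (𝕜 := ℝ) (Q * Qᵀ)‖ ≤ C * n := by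
    rw [one_div, ← div_eq_inv_mul, ← mul_div_assoc] at h2
    exact (div_le_div_iff_of_pos_right hd').1 h2
  have h4 := (Matrix.toEuclideanCLM (n := Fin n) (𝕜 := ℝ) (Q * Qᵀ)).le_opNorm v
  have h5 : Matrix.toEuclideanCLM (n := Fin n) (𝕜 := ℝ) (Q * Qᵀ) v =
      WithLp.toLp 2 (Q *ᵥ (Qᵀ *ᵥ v.ofLp)) := by
    rw [Matrix.mulVec_mulVec]
    rfl
  rw [h5] at h4
  exact h4.trans (mul_le_mul_of_nonneg_right h3 (norm_nonneg _))

theorem dotProduct_mul_transpose {v : Fin n → ℝ} (Q : Matrix (Fin n) (Fin d) ℝ) :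
    v ⬝ᵥ (Q *ᵥ (Qᵀ *ᵥ v)) = ‖WithLp.toLp 2 (Qᵀ *ᵥ v)‖ ^ 2 := by
  rw [Matrix.dotProduct_mulVec, ← Matrix.mulVec_transpose, dotProduct_self_eq_norm_sq]

/-- For a good sample the appended random direction keeps a fixed portion of the gradient. -/
theorem GoodSample.le_projected_gradient {C ε : ℝ} (hn : 0 < n) (hd : 0 < d) (hC : 0 < C)
    (hε : ε < 1) (hm : 2 ≤ m) {x : EuclideanSpace ℝ (Fin n)} {Q : Matrix (Fin n) (Fin d) ℝ}
    (h : GoodSample n d C ε (gradient f x) Q) (P : Matrix (Fin n) (Fin m) ℝ) :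
    ((1 - ε) * d / (C * n)) ^ 2 * ‖gradient f x‖ ^ 2 ≤
      ((nextP f Q x P)ᵀ *ᵥ grad f x) ⬝ᵥ ((nextP f Q x P)ᵀ *ᵥ grad f x) := by
  have hd' : (0 : ℝ) < d := by exact_mod_cast hd
  have hn' : (0 : ℝ) < n := by exact_mod_cast hn
  have h1 := h.le_norm_sq hd
  have h2 := h.norm_le hd
  set g := gradient f x with hg
  set z := WithLp.toLp 2 (Q *ᵥ (Qᵀ *ᵥ g.ofLp)) with hz
  set b := ‖WithLp.toLp 2 (Qᵀ *ᵥ g.ofLp)‖ ^ 2 with hb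
  -- The last column holds the normalized random direction; its inner product with `g` is `b / ‖z‖`,
  -- since `gᵀQQᵀg = ‖Qᵀg‖²`.
  let j : Fin m := ⟨m - 1, by omega⟩
  have h3 : ((nextP f Q x P)ᵀ *ᵥ grad f x) j = ‖z‖⁻¹ * b := by
    rw [hb, ← dotProduct_mul_transpose]
    have hj : ∀ i, nextP f Q x P i j = ‖z‖⁻¹ * z i := by
      intro i
      have e1 : ¬ j.val + 2 < m := by simp only [j]; omega
      have e2 : ¬ j.val + 2 = m := by simp only [j]; omega
      simp [nextP, e1, e2, normalized, grad, ← hg, hz]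
    simp only [Matrix.mulVec, dotProduct, Matrix.transpose_apply, hj]
    rw [Finset.mul_sum]
    refine Finset.sum_congr rfl fun i _ => ?_
    simp only [hz, grad, ← hg, Matrix.mulVec, dotProduct, Matrix.transpose_apply]
    ring
  have h4 : (‖z‖⁻¹ * b) ^ 2 ≤
      ((nextP f Q x P)ᵀ *ᵥ grad f x) ⬝ᵥ ((nextP f Q x P)ᵀ *ᵥ grad f x) := by
    rw [← h3, sq, dotProduct]
    exact Finset.single_le_sum (f := fun i => ((nextP f Q x P)ᵀ *ᵥ grad f x) i *
      ((nextP f Q x P)ᵀ *ᵥ grad f x) i) (fun i _ => mul_self_nonneg _) (Finset.mem_univ j)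
  refine le_trans ?_ h4
  rw [← mul_pow]
  have h0 : 0 ≤ (1 - ε) * d / (C * n) :=
    div_nonneg (mul_nonneg (by linarith) hd'.le) (by positivity)
  refine pow_le_pow_left₀ (mul_nonneg h0 (norm_nonneg _)) ?_ 2
  rcases eq_or_ne g 0 with hg0 | hg0
  · rw [hg0, norm_zero, mul_zero]
    positivity
  have hgpos : 0 < ‖g‖ := norm_pos_iff.2 hg0
  -- For `g ≠ 0` a good sample forces `gᵀz = b > 0`, so `z ≠ 0` and the convention for a zero
  -- denominator does not intervene.
  have hbpos : 0 < b := lt_of_lt_of_le (mul_pos (mul_pos (by linarith) hd') (by positivity)) h1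
  have hzpos : 0 < ‖z‖ := by
    rw [norm_pos_iff]
    intro hz0
    have : b = inner ℝ g z := by
      rw [← dotProduct_eq_inner, hb, ← dotProduct_mul_transpose]
    rw [hz0, inner_zero_right] at this
    exact hbpos.ne' this
  rw [← div_eq_inv_mul, le_div_iff₀ hzpos]
  calc (1 - ε) * d / (C * n) * ‖g‖ * ‖z‖ ≤ (1 - ε) * d / (C * n) * ‖g‖ * (C * n * ‖g‖) := by
        gcongr
    _ = (1 - ε) * d * ‖g‖ ^ 2 := by field_simp
    _ ≤ b := h1

end Step

/-! ### Measurability of the iterates -/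

section MatrixBorel

variable {ι κ : Type*} [Fintype ι] [Fintype κ]

instance : SecondCountableTopology (Matrix ι κ ℝ) :=
  inferInstanceAs (SecondCountableTopology (ι → κ → ℝ))

instance : TopologicalSpace.PseudoMetrizableSpace (Matrix ι κ ℝ) :=
  inferInstanceAs (TopologicalSpace.PseudoMetrizableSpace (ι → κ → ℝ))

instance : BorelSpace (Matrix ι κ ℝ) :=
  inferInstanceAs (BorelSpace (ι → κ → ℝ))

end MatrixBorel

section Measurability

variable {Ω : Type*} [MeasurableSpace Ω] {ι κ τ : Type*}

theorem measurable_matrix_iff {A : Ω → Matrix ι κ ℝ} :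
    Measurable A ↔ ∀ i j, Measurable fun ω => A ω i j := by
  constructor
  · intro h i j
    exact (measurable_pi_apply j).comp ((measurable_pi_apply i).comp h)
  · intro h
    exact measurable_pi_lambda _ fun i => measurable_pi_lambda _ fun j => h i j

variable [Fintype ι] [Fintype κ] [Fintype τ]

theorem measurable_matrix_mulVec {A : Ω → Matrix ι κ ℝ} {u : Ω → κ → ℝ} (hA : Measurable A)
    (hu : Measurable u) : Measurable fun ω => A ω *ᵥ u ω :=
  (by fun_prop : Continuous fun p : Matrix ι κ ℝ × (κ → ℝ) => p.1 *ᵥ p.2).measurable.comp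
    (hA.prodMk hu)

theorem measurable_matrix_mul {A : Ω → Matrix ι κ ℝ} {B : Ω → Matrix κ τ ℝ} (hA : Measurable A)
    (hB : Measurable B) : Measurable fun ω => A ω * B ω :=
  (by fun_prop : Continuous fun p : Matrix ι κ ℝ × Matrix κ τ ℝ => p.1 * p.2).measurable.comp
    (hA.prodMk hB)

theorem measurable_matrix_transpose {A : Ω → Matrix ι κ ℝ} (hA : Measurable A) :
    Measurable fun ω => (A ω)ᵀ :=
  (by fun_prop : Continuous fun B : Matrix ι κ ℝ => Bᵀ).measurable.comp hA

theorem measurable_dotProduct {u v : Ω → κ → ℝ} (hu : Measurable u) (hv : Measurable v) :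
    Measurable fun ω => u ω ⬝ᵥ v ω := by
  unfold dotProduct
  fun_prop

theorem measurable_grad {n : ℕ} {f : EuclideanSpace ℝ (Fin n) → ℝ}
    (hg : Measurable (gradient f)) : Measurable (grad f) :=
  (WithLp.measurable_ofLp 2 (Fin n → ℝ)).comp hg

theorem measurable_normalized {n : ℕ} : Measurable (normalized (n := n)) := by
  unfold normalized
  fun_prop

theorem measurable_subGrad {n m : ℕ} {f : EuclideanSpace ℝ (Fin n) → ℝ}
    (hg : Measurable (gradient f)) {x : Ω → EuclideanSpace ℝ (Fin n)}
    {P : Ω → Matrix (Fin n) (Fin m) ℝ} {u : Ω → Fin m → ℝ} (hx : Measurable x)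
    (hP : Measurable P) (hu : Measurable u) :
    Measurable fun ω => subGrad f (x ω) (P ω) (u ω) := by
  have h := (WithLp.measurable_toLp 2 (Fin n → ℝ)).comp (measurable_matrix_mulVec hP hu)
  exact measurable_matrix_mulVec (measurable_matrix_transpose hP)
    ((measurable_grad hg).comp (hx.add h))

theorem measurable_nextP {n d m : ℕ} {f : EuclideanSpace ℝ (Fin n) → ℝ}
    (hg : Measurable (gradient f)) {Q : Ω → Matrix (Fin n) (Fin d) ℝ}
    {x : Ω → EuclideanSpace ℝ (Fin n)} {P : Ω → Matrix (Fin n) (Fin m) ℝ} (hQ : Measurable Q)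
    (hx : Measurable x) (hP : Measurable P) :
    Measurable fun ω => nextP f (Q ω) (x ω) (P ω) := by
  rw [measurable_matrix_iff]
  intro i j
  by_cases h : j.val + 2 < m
  · simpa [nextP, h] using measurable_matrix_iff.1 hP i ⟨j.val + 2, h⟩
  by_cases h' : j.val + 2 = m
  · have h1 := (WithLp.measurable_ofLp 2 (Fin n → ℝ)).comp (measurable_normalized.comp hx)
    simpa [nextP, h', Function.comp_def] using (measurable_pi_apply i).comp h1
  · have h1 := measurable_matrix_mulVec hQ (measurable_matrix_mulVec
      (measurable_matrix_transpose hQ) ((measurable_grad hg).comp hx))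
    have h2 := (WithLp.measurable_ofLp 2 (Fin n → ℝ)).comp
      (measurable_normalized.comp ((WithLp.measurable_toLp 2 (Fin n → ℝ)).comp h1))
    simpa [nextP, h, h', Function.comp_def] using (measurable_pi_apply i).comp h2

theorem measurable_bfgs {m : ℕ} {H : Ω → Matrix (Fin m) (Fin m) ℝ} {s y : Ω → Fin m → ℝ}
    (hH : Measurable H) (hs : Measurable s) (hy : Measurable y) :
    Measurable fun ω => bfgs (H ω) (s ω) (y ω) := by
  have hd := measurable_dotProduct hs hy
  have h1 : ∀ a b : Ω → Fin m → ℝ, Measurable a → Measurable b →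
      Measurable fun ω => (1 / (s ω ⬝ᵥ y ω)) • Matrix.vecMulVec (a ω) (b ω) := by
    intro a b ha hb
    rw [measurable_matrix_iff]
    intro i j
    simp only [Matrix.smul_apply, Matrix.vecMulVec_apply, smul_eq_mul]
    fun_prop
  have h2 : ∀ a b : Ω → Fin m → ℝ, Measurable a → Measurable b →
      Measurable fun ω => (1 : Matrix (Fin m) (Fin m) ℝ) -
        (1 / (s ω ⬝ᵥ y ω)) • Matrix.vecMulVec (a ω) (b ω) := by
    intro a b ha hb
    rw [measurable_matrix_iff]
    intro i j
    exact measurable_const.sub (measurable_matrix_iff.1 (h1 a b ha hb) i j)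
  have h3 := measurable_matrix_mul (measurable_matrix_mul (h2 s y hs hy) hH) (h2 y s hy hs)
  rw [measurable_matrix_iff]
  intro i j
  exact (measurable_matrix_iff.1 h3 i j).add (measurable_matrix_iff.1 (h1 s s hs hs) i j)

theorem measurable_sInf_nat {S : Ω → Set ℕ} (hS : ∀ i, MeasurableSet {ω | i ∈ S ω}) :
    Measurable fun ω => sInf (S ω) := by
  refine measurable_to_countable' fun i => ?_
  -- The second set accounts for the default `sInf ∅ = 0`.
  have h : (fun ω => sInf (S ω)) ⁻¹' {i} =
      ({ω | i ∈ S ω} ∩ ⋂ j ∈ Set.Iio i, {ω | j ∈ S ω}ᶜ) ∪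
        ({_ω | i = 0} ∩ ⋂ j, {ω | j ∈ S ω}ᶜ) := by
    ext ω
    simp only [Set.mem_preimage, Set.mem_singleton_iff, Set.mem_union, Set.mem_inter_iff,
      Set.mem_ofPred_eq, Set.mem_iInter, Set.mem_Iio, Set.mem_compl_iff]
    constructor
    · rintro rfl
      rcases (S ω).eq_empty_or_nonempty with h | h
      · right
        simp [h]
      · exact Or.inl ⟨Nat.sInf_mem h, fun j hj => Nat.notMem_of_lt_sInf hj⟩
    · rintro (⟨h1, h2⟩ | ⟨rfl, h2⟩)
      · refine le_antisymm (Nat.sInf_le h1) ?_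
        by_contra h3
        exact h2 _ (not_le.1 h3) (Nat.sInf_mem ⟨i, h1⟩)
      · rw [Set.eq_empty_of_forall_notMem h2, Nat.sInf_empty]
  rw [h]
  exact ((hS i).inter (MeasurableSet.biInter (Set.to_countable _) fun j _ => (hS j).compl)).union
    ((MeasurableSet.const _).inter (MeasurableSet.iInter fun j => (hS j).compl))

theorem measurable_stepSize {n m : ℕ} {f : EuclideanSpace ℝ (Fin n) → ℝ} {β c : ℝ}
    (hf : Measurable f) (hg : Measurable (gradient f)) {x : Ω → EuclideanSpace ℝ (Fin n)}
    {P : Ω → Matrix (Fin n) (Fin m) ℝ} {u : Ω → Fin m → ℝ} (hx : Measurable x)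
    (hP : Measurable P) (hu : Measurable u) :
    Measurable fun ω => stepSize f β c (x ω) (P ω) (u ω) := by
  refine (measurable_of_countable fun i : ℕ => β ^ i).comp (measurable_sInf_nat fun i => ?_)
  have h1 := (WithLp.measurable_toLp 2 (Fin n → ℝ)).comp
    (measurable_matrix_mulVec hP (hu.const_smul (β ^ i)))
  have h2 := measurable_dotProduct (measurable_subGrad hg hx hP
    (measurable_const (a := (0 : Fin m → ℝ)))) hu
  exact measurableSet_le (hf.comp (hx.add h1)) ((hf.comp hx).add (h2.const_mul _))

/-- A pointwise limit of polynomials in `H`: the `N`-th one is within `1/(N+1)` of `φ` on `[-N, N]`,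
and these intervals eventually contain the compact spectrum of any given `H`. Off the closed set of
symmetric matrices `cfc` is `0`, hence the case distinction. -/
theorem measurable_cfc {m : ℕ} {φ : ℝ → ℝ} (hφ : Continuous φ) :
    Measurable fun H : Matrix (Fin m) (Fin m) ℝ => cfc φ H := by
  classical
  choose p hp using fun N : ℕ => exists_polynomial_near_of_continuousOn (-N) N φ
    hφ.continuousOn (1 / ((N : ℝ) + 1)) (by positivity)
  have hclosed : MeasurableSet {H : Matrix (Fin m) (Fin m) ℝ | IsSelfAdjoint H} :=
    (isClosed_eq continuous_star continuous_id).measurableSet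
  refine measurable_of_tendsto_metrizable (f := fun N H => if IsSelfAdjoint H then
    Polynomial.aeval H (p N) else 0) (fun N => ?_) (tendsto_pi_nhds.2 fun H => ?_)
  · exact Measurable.ite hclosed (p N).continuous_aeval.measurable measurable_const
  · by_cases hH : IsSelfAdjoint H
    · simp only [hH, if_true]
      simp_rw [← fun N => cfc_polynomial (p := IsSelfAdjoint) (p N) H hH]
      refine tendsto_cfc_fun ?_ (Eventually.of_forall fun N => (p N).continuous.continuousOn)
      obtain ⟨R, hR⟩ := (isCompact_iff_compactSpace.2
        (inferInstance : CompactSpace (spectrum ℝ H))).isBounded.exists_norm_le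
      rw [Metric.tendstoUniformlyOn_iff]
      intro ε hε
      filter_upwards [eventually_ge_atTop ⌈R⌉₊,
        (tendsto_one_div_add_atTop_nhds_zero_nat (𝕜 := ℝ)).eventually (gt_mem_nhds hε)]
        with N hN hNε x hx
      have hxN : |x| ≤ N := (hR x hx).trans ((Nat.le_ceil R).trans (by exact_mod_cast hN))
      rw [dist_comm, Real.dist_eq]
      exact (hp N x (abs_le.1 hxN)).trans hNε
    · simp only [hH, if_false]
      rw [cfc_apply_of_not_predicate H hH]
      exact tendsto_const_nhds

/-- The three components of a random state are measurable. -/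
structure MeasurableState {n m : ℕ} (S : Ω → State n m) : Prop where
  x : Measurable fun ω => (S ω).x
  P : Measurable fun ω => (S ω).P
  H : Measurable fun ω => (S ω).H

theorem MeasurableState.step {n d m : ℕ} {f : EuclideanSpace ℝ (Fin n) → ℝ} {β c M₁ M₂ : ℝ}
    (hf : Measurable f) (hg : Measurable (gradient f)) {Q : Ω → Matrix (Fin n) (Fin d) ℝ}
    {S : Ω → State n m} (hQ : Measurable Q) (hS : MeasurableState S) :
    MeasurableState fun ω => step f β c M₁ M₂ (Q ω) (S ω) := by
  have hP := measurable_nextP hg hQ hS.x hS.P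
  have h0 := measurable_subGrad hg hS.x hP (measurable_const (a := (0 : Fin m → ℝ)))
  have hu := (measurable_matrix_mulVec hS.H h0).neg
  have hα := measurable_stepSize (β := β) (c := c) hf hg hS.x hP hu
  have hs := hα.smul hu
  exact ⟨hS.x.add ((WithLp.measurable_toLp 2 (Fin n → ℝ)).comp (measurable_matrix_mulVec hP hs)),
    hP, (measurable_cfc (by fun_prop)).comp
      (measurable_bfgs hS.H hs ((measurable_subGrad hg hS.x hP hs).sub h0))⟩

theorem measurableState_run {n d m : ℕ} {f : EuclideanSpace ℝ (Fin n) → ℝ} {β c M₁ M₂ : ℝ}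
    (hf : Measurable f) (hg : Measurable (gradient f)) (S₀ : State n m) (k : ℕ) :
    MeasurableState fun q : ℕ → Matrix (Fin n) (Fin d) ℝ => run f β c M₁ M₂ S₀ q k := by
  induction k with
  | zero => exact ⟨measurable_const (a := S₀.x), measurable_const (a := S₀.P),
      measurable_const (a := S₀.H)⟩
  | succ k ih => exact ih.step hf hg (measurable_pi_apply k)

end Measurability

theorem run_congr {n d m : ℕ} {f : EuclideanSpace ℝ (Fin n) → ℝ} {β c M₁ M₂ : ℝ}
    (S₀ : State n m) {q q' : ℕ → Matrix (Fin n) (Fin d) ℝ} {k : ℕ}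
    (h : ∀ j < k, q j = q' j) :
    run f β c M₁ M₂ S₀ q k = run f β c M₁ M₂ S₀ q' k := by
  induction k with
  | zero => rfl
  | succ k ih =>
    rw [run, run, ih fun j hj => h j (hj.trans k.lt_succ_self), h k k.lt_succ_self]

instance (n d : ℕ) : IsProbabilityMeasure (gaussianMatrix n d) :=
  inferInstanceAs (IsProbabilityMeasure (Measure.pi fun _ : Fin n =>
    Measure.pi fun _ : Fin d => gaussianReal 0 1))

/-! ### Law and exponential moments of the Gaussian matrix -/

section Law

variable {n d : ℕ}

theorem charFunDual_gaussianReal_zero_one (L : StrongDual ℝ ℝ) :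
    charFunDual (gaussianReal 0 1) L = Complex.exp (-((L 1 : ℂ) ^ 2 / 2)) := by
  have h : charFunDual (gaussianReal 0 1) L = charFun (gaussianReal 0 1) (L 1) := by
    rw [charFunDual_apply, charFun_apply_real]
    refine integral_congr_ae (Eventually.of_forall fun v => ?_)
    have hv : L v = L 1 * v := by
      conv_lhs => rw [← mul_one v, ← smul_eq_mul, map_smul, smul_eq_mul, mul_comm]
    simp only [hv]
    push_cast
    rfl
  rw [h, charFun_gaussianReal]
  congr 1
  simp

/-- The product of a standard Gaussian matrix with a unit vector is a standard Gaussian vector. -/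
theorem map_gaussianMatrix_transpose_mulVec {x : EuclideanSpace ℝ (Fin n)} (hx : ‖x‖ = 1) :
    (gaussianMatrix n d).map (fun Q => Qᵀ *ᵥ x.ofLp) =
      Measure.pi fun _ : Fin d => gaussianReal 0 1 := by
  let A : (Fin n → Fin d → ℝ) →L[ℝ] (Fin d → ℝ) :=
    ∑ i, x i • ContinuousLinearMap.proj (R := ℝ) (φ := fun _ : Fin n => Fin d → ℝ) i
  have hA : (fun Q : Matrix (Fin n) (Fin d) ℝ => Qᵀ *ᵥ x.ofLp) = A := by
    have hA' : ∀ q : Fin n → Fin d → ℝ, A q = fun j => ∑ i, q i j * x i := by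
      intro q
      ext j
      simp [A, mul_comm]
    funext Q
    exact (hA' Q).symm
  have h : (Measure.pi fun _ : Fin n => Measure.pi fun _ : Fin d => gaussianReal 0 1).map A =
      Measure.pi fun _ : Fin d => gaussianReal 0 1 := by
    -- Both exponents are sums over `j` of `-(L e_j)²/2`; on the left each term carries the factor
    -- `∑ i, x i ^ 2 = 1`.
    apply Measure.ext_of_charFunDual
    ext L
    rw [charFunDual_map]
    simp_rw [charFunDual_pi, charFunDual_gaussianReal_zero_one, ← Complex.exp_sum]
    congr 1
    have hsingle : ∀ i j, A (Pi.single i (Pi.single j 1)) = x i • Pi.single j 1 := by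
      intro i j
      simp [A, Pi.single_apply]
    have hcoef : ∀ i j, (((L.comp A).comp (.single ℝ (fun _ : Fin n => Fin d → ℝ) i)).comp
        (.single ℝ (fun _ : Fin d => ℝ) j)) 1 = x i * L (Pi.single j 1) := by
      intro i j
      simp [hsingle]
    simp_rw [hcoef]
    have hx2 : ∑ i, (x i : ℂ) ^ 2 = 1 := by
      have := EuclideanSpace.real_norm_sq_eq x
      rw [hx, one_pow] at this
      exact_mod_cast this.symm
    rw [Finset.sum_comm]
    refine Finset.sum_congr rfl fun j _ => ?_
    have e : ∀ i, -(((x i * L (Pi.single j 1) : ℝ) : ℂ) ^ 2 / 2) =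
        (x i : ℂ) ^ 2 * -((L (Pi.single j 1) : ℂ) ^ 2 / 2) := by
      intro i
      push_cast
      ring
    simp_rw [e, ← Finset.sum_mul, hx2, one_mul]
    simp
  rw [hA]
  exact h

theorem integral_exp_mul_sq_gaussianReal {t : ℝ} (ht : t < 1 / 2) :
    ∫ x, Real.exp (t * x ^ 2) ∂(gaussianReal 0 1) = √(1 / (1 - 2 * t)) := by
  rw [integral_gaussianReal_eq_integral_smul one_ne_zero]
  have h : ∀ x : ℝ, gaussianPDFReal 0 1 x • Real.exp (t * x ^ 2) =
      (√(2 * Real.pi))⁻¹ * Real.exp (-(1 / 2 - t) * x ^ 2) := by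
    intro x
    simp only [gaussianPDFReal, NNReal.coe_one, mul_one, sub_zero, smul_eq_mul]
    rw [mul_assoc, ← Real.exp_add]
    ring_nf
  simp_rw [h]
  rw [integral_const_mul, integral_gaussian, ← Real.sqrt_inv, ← Real.sqrt_mul (by positivity)]
  congr 1
  have : 1 / 2 - t ≠ 0 := by linarith
  have : 1 - 2 * t ≠ 0 := by linarith
  field_simp

theorem integral_exp_mul_norm_sq {x : EuclideanSpace ℝ (Fin n)} (hx : ‖x‖ = 1) {t : ℝ}
    (ht : t < 1 / 2) :
    ∫ Q, Real.exp (t * ‖WithLp.toLp 2 (Qᵀ *ᵥ x.ofLp)‖ ^ 2) ∂(gaussianMatrix n d) =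
      √(1 / (1 - 2 * t)) ^ d := by
  have hm : Measurable fun Q : Matrix (Fin n) (Fin d) ℝ => Qᵀ *ᵥ x.ofLp :=
    measurable_matrix_mulVec (measurable_matrix_transpose measurable_id) measurable_const
  have hc : Continuous fun y : Fin d → ℝ => Real.exp (t * ‖WithLp.toLp 2 y‖ ^ 2) := by fun_prop
  rw [← integral_map (f := fun y : Fin d → ℝ => Real.exp (t * ‖WithLp.toLp 2 y‖ ^ 2))
    hm.aemeasurable hc.aestronglyMeasurable, map_gaussianMatrix_transpose_mulVec hx]
  have h : ∀ y : Fin d → ℝ, Real.exp (t * ‖WithLp.toLp 2 y‖ ^ 2) =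
      ∏ j, Real.exp (t * y j ^ 2) := by
    intro y
    rw [EuclideanSpace.real_norm_sq_eq, Finset.mul_sum, Real.exp_sum]
  simp_rw [h]
  rw [integral_fintype_prod_eq_prod (fun _ z => Real.exp (t * z ^ 2))]
  simp [integral_exp_mul_sq_gaussianReal ht]

theorem integrable_exp_mul_norm_sq {x : EuclideanSpace ℝ (Fin n)} (hx : ‖x‖ = 1) {t : ℝ}
    (ht : t < 1 / 2) :
    Integrable (fun Q => Real.exp (t * ‖WithLp.toLp 2 (Qᵀ *ᵥ x.ofLp)‖ ^ 2))
      (gaussianMatrix n d) := by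
  -- The Bochner integral of a nonintegrable function is `0`, so the positive value already computed
  -- implies integrability.
  refine Integrable.of_integral_ne_zero ?_
  rw [integral_exp_mul_norm_sq hx ht]
  have : 0 < 1 - 2 * t := by linarith
  positivity

end Law

/-! ### Norm concentration by Chernoff bounds -/

section NormConcentration

variable {n d : ℕ}

/-- Taylor's bound `|log (1-s) + s| ≤ s²/(1-|s|)` at `s = 2t`, where `1 - |s| ≥ 1/2`, gives `-log
(1-2t) ≤ 2t + 8t²`; then halve. -/
theorem sqrt_one_div_one_sub_le {t : ℝ} (ht : |t| ≤ 1 / 4) :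
    √(1 / (1 - 2 * t)) ≤ Real.exp (t + 4 * t ^ 2) := by
  obtain ⟨h1, h2⟩ := abs_le.1 ht
  have hpos : 0 < 1 - 2 * t := by linarith
  have h3 : |2 * t| ≤ 1 / 2 := by
    rw [abs_mul, abs_two]
    linarith
  have h4 := Real.abs_log_sub_add_sum_range_le (x := 2 * t) (h3.trans_lt (by norm_num)) 1
  have h5 : |2 * t| ^ (1 + 1) / (1 - |2 * t|) ≤ 8 * t ^ 2 := by
    rw [div_le_iff₀ (by linarith), one_add_one_eq_two, sq_abs]
    nlinarith [sq_nonneg t]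
  have h6 := (abs_le.1 (h4.trans h5)).1
  simp only [Finset.range_one, Finset.sum_singleton, zero_add, pow_one, Nat.cast_zero,
    div_one] at h6
  rw [Real.sqrt_le_left (Real.exp_pos _).le, ← Real.exp_nat_mul, one_div,
    ← Real.exp_log hpos, ← Real.exp_neg, Real.exp_le_exp]
  push_cast
  linarith

theorem mgf_norm_sq_le {x : EuclideanSpace ℝ (Fin n)} (hx : ‖x‖ = 1) {t : ℝ}
    (ht : |t| ≤ 1 / 4) :
    mgf (fun Q => ‖WithLp.toLp 2 (Qᵀ *ᵥ x.ofLp)‖ ^ 2) (gaussianMatrix n d) t ≤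
      Real.exp (d * (t + 4 * t ^ 2)) := by
  rw [mgf, integral_exp_mul_norm_sq hx (by linarith [(abs_le.1 ht).2]), Real.exp_nat_mul]
  exact pow_le_pow_left₀ (Real.sqrt_nonneg _) (sqrt_one_div_one_sub_le ht) d

theorem measureReal_norm_sq_upper_tail {x : EuclideanSpace ℝ (Fin n)} (hx : ‖x‖ = 1) {ε : ℝ}
    (h0 : 0 < ε) (h1 : ε < 1) :
    (gaussianMatrix n d).real {Q | (1 + ε) * d ≤ ‖WithLp.toLp 2 (Qᵀ *ᵥ x.ofLp)‖ ^ 2} ≤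
      Real.exp (-(1 / 16 * ε ^ 2 * d)) := by
  -- The Chernoff exponent is `d (4t² - tε)`, minimal at `t = ε/8` with value `-ε²d/16`.
  have habs : |ε / 8| ≤ 1 / 4 := by rw [abs_of_pos (by positivity)]; linarith
  refine (measure_ge_le_exp_mul_mgf (t := ε / 8) _ (by positivity)
    (integrable_exp_mul_norm_sq hx (by linarith))).trans ?_
  refine (mul_le_mul_of_nonneg_left (mgf_norm_sq_le hx habs) (Real.exp_pos _).le).trans ?_
  rw [← Real.exp_add, Real.exp_le_exp]
  apply le_of_eq
  ring

theorem measureReal_norm_sq_lower_tail {x : EuclideanSpace ℝ (Fin n)} (hx : ‖x‖ = 1) {ε : ℝ}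
    (h0 : 0 < ε) (h1 : ε < 1) :
    (gaussianMatrix n d).real {Q | ‖WithLp.toLp 2 (Qᵀ *ᵥ x.ofLp)‖ ^ 2 ≤ (1 - ε) * d} ≤
      Real.exp (-(1 / 16 * ε ^ 2 * d)) := by
  have habs : |-(ε / 8)| ≤ 1 / 4 := by rw [abs_neg, abs_of_pos (by positivity)]; linarith
  refine (measure_le_le_exp_mul_mgf (t := -(ε / 8)) _ (by linarith)
    (integrable_exp_mul_norm_sq hx (by linarith))).trans ?_
  refine (mul_le_mul_of_nonneg_left (mgf_norm_sq_le hx habs) (Real.exp_pos _).le).trans ?_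
  rw [← Real.exp_add, Real.exp_le_exp]
  apply le_of_eq
  ring

theorem isNormConcentrationConst (hd : 0 < d) : IsNormConcentrationConst n d (1 / 16) := by
  have hd' : (0 : ℝ) < d := by exact_mod_cast hd
  refine ⟨by norm_num, fun ε h0 h1 x => ?_⟩
  rcases eq_or_ne x 0 with rfl | hx
  · have : 0 ≤ Real.exp (-(1 / 16 * ε ^ 2 * d)) := (Real.exp_pos _).le
    simpa using this
  have hxpos : 0 < ‖x‖ := norm_pos_iff.2 hx
  set v : EuclideanSpace ℝ (Fin n) := ‖x‖⁻¹ • x with hv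
  have hv1 : ‖v‖ = 1 := by
    rw [hv, norm_smul, norm_inv, norm_norm, inv_mul_cancel₀ hxpos.ne']
  have hxv : x = ‖x‖ • v := by rw [hv, smul_inv_smul₀ hxpos.ne']
  have hnorm : ∀ Q : Matrix (Fin n) (Fin d) ℝ,
      ‖(1 / √(d : ℝ)) • WithLp.toLp 2 (Qᵀ *ᵥ x.ofLp)‖ ^ 2 =
        ‖x‖ ^ 2 * (‖WithLp.toLp 2 (Qᵀ *ᵥ v.ofLp)‖ ^ 2 / d) := by
    intro Q
    have h : Qᵀ *ᵥ x.ofLp = ‖x‖ • (Qᵀ *ᵥ v.ofLp) := by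
      rw [← Matrix.mulVec_smul, ← WithLp.ofLp_smul, ← hxv]
    rw [h, WithLp.toLp_smul, norm_smul, norm_smul, norm_norm, mul_pow, mul_pow, norm_div,
      norm_one, Real.norm_of_nonneg (Real.sqrt_nonneg _), div_pow, Real.sq_sqrt hd'.le]
    ring
  set S := {Q : Matrix (Fin n) (Fin d) ℝ |
    (1 - ε) * ‖x‖ ^ 2 ≤ ‖(1 / √(d : ℝ)) • WithLp.toLp 2 (Qᵀ *ᵥ x.ofLp)‖ ^ 2 ∧
    ‖(1 / √(d : ℝ)) • WithLp.toLp 2 (Qᵀ *ᵥ x.ofLp)‖ ^ 2 ≤ (1 + ε) * ‖x‖ ^ 2} with hS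
  set U := {Q : Matrix (Fin n) (Fin d) ℝ |
    (1 + ε) * d ≤ ‖WithLp.toLp 2 (Qᵀ *ᵥ v.ofLp)‖ ^ 2} with hU
  set D := {Q : Matrix (Fin n) (Fin d) ℝ |
    ‖WithLp.toLp 2 (Qᵀ *ᵥ v.ofLp)‖ ^ 2 ≤ (1 - ε) * d} with hD
  have hcover : (Set.univ : Set (Matrix (Fin n) (Fin d) ℝ)) ⊆ S ∪ (U ∪ D) := by
    intro Q _
    by_cases hQ : Q ∈ U ∪ D
    · exact Or.inr hQ
    · left
      simp only [hU, hD, Set.mem_union, Set.mem_ofPred_eq, not_or, not_le] at hQ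
      simp only [hS, Set.mem_ofPred_eq, hnorm]
      constructor
      · rw [mul_comm (1 - ε)]
        gcongr
        rw [le_div_iff₀ hd']
        exact hQ.2.le
      · rw [mul_comm (1 + ε)]
        gcongr
        rw [div_le_iff₀ hd']
        exact hQ.1.le
  have h2 : (1 : ℝ) ≤ (gaussianMatrix n d).real S +
      ((gaussianMatrix n d).real U + (gaussianMatrix n d).real D) := by
    rw [← probReal_univ (μ := gaussianMatrix n d)]
    exact (measureReal_mono hcover).trans ((measureReal_union_le _ _).trans
      (add_le_add_right (measureReal_union_le _ _) _))
  linarith [measureReal_norm_sq_upper_tail (d := d) hv1 h0 h1,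
    measureReal_norm_sq_lower_tail (d := d) hv1 h0 h1]

end NormConcentration

/-! ### Operator norm by averaging over a ball -/

section OperatorNorm

variable {n d : ℕ}

/-- The map `v ↦ Qᵀ v` between Euclidean spaces. -/
noncomputable def transposeCLM (Q : Matrix (Fin n) (Fin d) ℝ) :
    EuclideanSpace ℝ (Fin n) →L[ℝ] EuclideanSpace ℝ (Fin d) :=
  LinearMap.toContinuousLinearMap (Matrix.toLpLin 2 2 Qᵀ)

theorem transposeCLM_apply (Q : Matrix (Fin n) (Fin d) ℝ) (v : EuclideanSpace ℝ (Fin n)) :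
    transposeCLM Q v = WithLp.toLp 2 (Qᵀ *ᵥ v.ofLp) := rfl

/-- For `z = QQᵀv` one has `‖z‖² = ⟨Qᵀz, Qᵀv⟩ ≤ ‖Qᵀ‖² ‖z‖ ‖v‖`; cancel `‖z‖`. -/
theorem norm_toEuclideanCLM_mul_transpose_le (Q : Matrix (Fin n) (Fin d) ℝ) :
    ‖Matrix.toEuclideanCLM (n := Fin n) (𝕜 := ℝ) (Q * Qᵀ)‖ ≤ ‖transposeCLM Q‖ ^ 2 := by
  refine ContinuousLinearMap.opNorm_le_bound _ (by positivity) fun v => ?_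
  set z := Matrix.toEuclideanCLM (n := Fin n) (𝕜 := ℝ) (Q * Qᵀ) v with hz
  have hzv : z.ofLp = Q *ᵥ (Qᵀ *ᵥ v.ofLp) := by
    rw [Matrix.mulVec_mulVec]
    rfl
  have h1 : ‖z‖ ^ 2 = inner ℝ (transposeCLM Q z) (transposeCLM Q v) := by
    rw [← dotProduct_eq_inner, transposeCLM_apply, transposeCLM_apply,
      ← real_inner_self_eq_norm_sq, ← dotProduct_eq_inner]
    conv_lhs => rw [hzv, Matrix.dotProduct_mulVec, ← Matrix.mulVec_transpose, ← hzv]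
  have h2 := real_inner_le_norm (transposeCLM Q z) (transposeCLM Q v)
  have h3 := (transposeCLM Q).le_opNorm z
  have h4 := (transposeCLM Q).le_opNorm v
  rcases (norm_nonneg z).eq_or_lt with h0 | h0
  · rw [← h0]
    positivity
  have h5 : ‖z‖ * ‖z‖ ≤ ‖z‖ * (‖transposeCLM Q‖ ^ 2 * ‖v‖) := by
    calc ‖z‖ * ‖z‖ = ‖z‖ ^ 2 := (sq _).symm
      _ ≤ (‖transposeCLM Q‖ * ‖z‖) * (‖transposeCLM Q‖ * ‖v‖) := by
        rw [h1]
        exact h2.trans (mul_le_mul h3 h4 (norm_nonneg _) (by positivity))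
      _ = ‖z‖ * (‖transposeCLM Q‖ ^ 2 * ‖v‖) := by ring
  exact le_of_mul_le_mul_left h5 h0

/-- A large operator norm makes the exponential moment over a ball large. -/
theorem exp_mul_volume_le_setLIntegral {Q : Matrix (Fin n) (Fin d) ℝ} {r : ℝ} (hr : 0 < r)
    (hQ : r ^ 2 < ‖transposeCLM Q‖ ^ 2) :
    ENNReal.ofReal (Real.exp (r ^ 2 / 64)) *
        volume (Metric.ball (0 : EuclideanSpace ℝ (Fin n)) (1 / 4)) ≤
      ∫⁻ v in Metric.ball (0 : EuclideanSpace ℝ (Fin n)) 2,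
        ENNReal.ofReal (Real.exp (1 / 16 * ‖WithLp.toLp 2 (Qᵀ *ᵥ v.ofLp)‖ ^ 2)) := by
  have ha : r < ‖transposeCLM Q‖ := lt_of_pow_lt_pow_left₀ 2 (norm_nonneg _) hQ
  set a := ‖transposeCLM Q‖ with ha'
  -- Within `1/4` of a near-maximizer `u`, the value `‖Qᵀv‖` stays above `3a/4 - a/4 = a/2 > r/2`,
  -- whose square over `16` exceeds `r²/64`.
  obtain ⟨u, hu, hua⟩ := (transposeCLM Q).exists_lt_apply_of_lt_opNorm
    (r := 3 / 4 * a) (by linarith)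
  have hsub : Metric.ball u (1 / 4) ⊆ Metric.ball 0 2 := by
    intro v hv
    rw [mem_ball_zero_iff]
    rw [mem_ball_iff_norm] at hv
    have := norm_add_le (v - u) u
    rw [sub_add_cancel] at this
    linarith
  calc ENNReal.ofReal (Real.exp (r ^ 2 / 64)) *
        volume (Metric.ball (0 : EuclideanSpace ℝ (Fin n)) (1 / 4))
      = ∫⁻ _v in Metric.ball u (1 / 4), ENNReal.ofReal (Real.exp (r ^ 2 / 64)) := by
        rw [setLIntegral_const, Measure.addHaar_ball_center volume u]
    _ ≤ ∫⁻ v in Metric.ball u (1 / 4),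
        ENNReal.ofReal (Real.exp (1 / 16 * ‖WithLp.toLp 2 (Qᵀ *ᵥ v.ofLp)‖ ^ 2)) := by
        refine setLIntegral_mono' measurableSet_ball fun v hv => ?_
        rw [← transposeCLM_apply]
        rw [mem_ball_iff_norm'] at hv
        have h1 := (transposeCLM Q).le_opNorm (u - v)
        rw [map_sub] at h1
        have h2 := norm_sub_norm_le (transposeCLM Q u) (transposeCLM Q v)
        have h3 : ‖transposeCLM Q‖ * ‖u - v‖ ≤ a * (1 / 4) := by gcongr
        have h4 : r / 2 ≤ ‖transposeCLM Q v‖ := by linarith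
        have h5 := pow_le_pow_left₀ (by positivity) h4 2
        gcongr
        linarith
    _ ≤ _ := lintegral_mono_set hsub

/-- After normalizing `v` the exponent parameter is `‖v‖²/16 ≤ 1/4`, safely below the critical value
`1/2`. -/
theorem lintegral_exp_norm_sq_le {v : EuclideanSpace ℝ (Fin n)} (hv : ‖v‖ < 2) :
    ∫⁻ Q, ENNReal.ofReal (Real.exp (1 / 16 * ‖WithLp.toLp 2 (Qᵀ *ᵥ v.ofLp)‖ ^ 2))
      ∂(gaussianMatrix n d) ≤ 2 ^ d := by
  rcases eq_or_ne v 0 with rfl | h0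
  · simp [one_le_pow₀ (one_le_two : (1 : ENNReal) ≤ 2)]
  have hvpos : 0 < ‖v‖ := norm_pos_iff.2 h0
  set u : EuclideanSpace ℝ (Fin n) := ‖v‖⁻¹ • v with hu
  have hu1 : ‖u‖ = 1 := by
    rw [hu, norm_smul, norm_inv, norm_norm, inv_mul_cancel₀ hvpos.ne']
  have hvu : v = ‖v‖ • u := by rw [hu, smul_inv_smul₀ hvpos.ne']
  have ht : ‖v‖ ^ 2 / 16 ≤ 1 / 4 := by nlinarith
  have hnorm : ∀ Q : Matrix (Fin n) (Fin d) ℝ,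
      1 / 16 * ‖WithLp.toLp 2 (Qᵀ *ᵥ v.ofLp)‖ ^ 2 =
        ‖v‖ ^ 2 / 16 * ‖WithLp.toLp 2 (Qᵀ *ᵥ u.ofLp)‖ ^ 2 := by
    intro Q
    have h : Qᵀ *ᵥ v.ofLp = ‖v‖ • (Qᵀ *ᵥ u.ofLp) := by
      rw [← Matrix.mulVec_smul, ← WithLp.ofLp_smul, ← hvu]
    rw [h, WithLp.toLp_smul, norm_smul, norm_norm, mul_pow]
    ring
  simp_rw [hnorm]
  rw [← ofReal_integral_eq_lintegral_ofReal (integrable_exp_mul_norm_sq hu1 (by linarith))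
    (Eventually.of_forall fun _ => (Real.exp_pos _).le),
    integral_exp_mul_norm_sq hu1 (by linarith), ENNReal.ofReal_pow (Real.sqrt_nonneg _)]
  refine pow_le_pow_left' ?_ d
  refine ENNReal.ofReal_le_of_le_toReal ?_
  rw [ENNReal.toReal_ofNat, Real.sqrt_le_left (by norm_num), div_le_iff₀ (by linarith)]
  linarith

theorem volume_ball_two :
    volume (Metric.ball (0 : EuclideanSpace ℝ (Fin n)) 2) =
      8 ^ n * volume (Metric.ball (0 : EuclideanSpace ℝ (Fin n)) (1 / 4)) := by
  have h := Measure.addHaar_ball_mul_of_pos (volume : Measure (EuclideanSpace ℝ (Fin n))) 0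
    (r := 8) (by norm_num) (1 / 4)
  rw [finrank_euclideanSpace_fin, ENNReal.ofReal_pow (by norm_num)] at h
  norm_num at h
  simpa using h

/-- Markov's inequality for `F`: its mean is at most `2^d 8^n V ≤ 16^n V`, the volume ratio `8^n`
playing the role of a covering number, while `F ≥ exp(4n) V` on the event, as `256 n / 64 = 4n`. -/
theorem measure_operatorNorm_tail (hn : 0 < n) (hdn : d ≤ n) :
    gaussianMatrix n d {Q | 256 * (n : ℝ) < ‖transposeCLM Q‖ ^ 2} ≤
      ENNReal.ofReal (Real.exp (-(d : ℝ))) := by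
  have hn' : (0 : ℝ) < n := by exact_mod_cast hn
  set V := volume (Metric.ball (0 : EuclideanSpace ℝ (Fin n)) (1 / 4)) with hV
  have hV0 : V ≠ 0 := (Metric.measure_ball_pos volume 0 (by norm_num)).ne'
  have hVtop : V ≠ ⊤ := measure_ball_lt_top.ne
  have hmeas : Measurable fun p : Matrix (Fin n) (Fin d) ℝ × EuclideanSpace ℝ (Fin n) =>
      ENNReal.ofReal (Real.exp (1 / 16 * ‖WithLp.toLp 2 (p.1ᵀ *ᵥ p.2.ofLp)‖ ^ 2)) := by
    have h := (WithLp.measurable_toLp 2 (Fin d → ℝ)).comp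
      (measurable_matrix_mulVec (measurable_matrix_transpose measurable_fst)
        ((WithLp.measurable_ofLp 2 (Fin n → ℝ)).comp measurable_snd) :
        Measurable fun p : Matrix (Fin n) (Fin d) ℝ × EuclideanSpace ℝ (Fin n) =>
          p.1ᵀ *ᵥ p.2.ofLp)
    exact ((h.norm.pow_const 2).const_mul _).exp.ennreal_ofReal
  set F : Matrix (Fin n) (Fin d) ℝ → ENNReal := fun Q =>
    ∫⁻ v in Metric.ball (0 : EuclideanSpace ℝ (Fin n)) 2,
      ENNReal.ofReal (Real.exp (1 / 16 * ‖WithLp.toLp 2 (Qᵀ *ᵥ v.ofLp)‖ ^ 2)) with hF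
  have hFmeas : Measurable F := hmeas.lintegral_prod_right'
  have hint : ∫⁻ Q, F Q ∂(gaussianMatrix n d) ≤ 16 ^ n * V := by
    rw [hF, lintegral_lintegral_swap hmeas.aemeasurable]
    calc _ ≤ ∫⁻ _v in Metric.ball (0 : EuclideanSpace ℝ (Fin n)) 2, (2 : ENNReal) ^ d :=
          setLIntegral_mono' measurableSet_ball fun v hv =>
            lintegral_exp_norm_sq_le (mem_ball_zero_iff.1 hv)
      _ = 2 ^ d * (8 ^ n * V) := by rw [setLIntegral_const, volume_ball_two]
      _ ≤ 2 ^ n * (8 ^ n * V) := by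
          gcongr
          exact one_le_two
      _ = 16 ^ n * V := by
          rw [← mul_assoc, ← mul_pow]
          norm_num
  set c := ENNReal.ofReal (Real.exp (4 * n)) * V with hc
  have hsub : {Q | 256 * (n : ℝ) < ‖transposeCLM Q‖ ^ 2} ⊆
      {Q : Matrix (Fin n) (Fin d) ℝ | c ≤ F Q} := by
    intro Q hQ
    have h1 : √(256 * (n : ℝ)) ^ 2 = 256 * n := Real.sq_sqrt (by positivity)
    have h2 := exp_mul_volume_le_setLIntegral (Q := Q) (r := √(256 * (n : ℝ)))
      (by positivity) (by rw [h1]; exact hQ)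
    rw [h1, show 256 * (n : ℝ) / 64 = 4 * n by ring] at h2
    exact h2
  have hmarkov := (mul_le_mul_right (measure_mono (μ := gaussianMatrix n d) hsub) c).trans
    ((mul_meas_ge_le_lintegral hFmeas c).trans hint)
  -- Since `16 ≤ e³`, one has `16^n ≤ exp(4n - n) ≤ exp(4n - d)`.
  have h16 : (16 : ENNReal) ^ n ≤
      ENNReal.ofReal (Real.exp (4 * n)) * ENNReal.ofReal (Real.exp (-(d : ℝ))) := by
    have he : (16 : ℝ) ≤ Real.exp 3 := by
      have h1 := Real.exp_one_gt_d9
      have h2 : Real.exp 3 = Real.exp 1 ^ 3 := by rw [← Real.exp_nat_mul]; norm_num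
      rw [h2]
      calc (16 : ℝ) ≤ 2.7 ^ 3 := by norm_num
        _ ≤ Real.exp 1 ^ 3 := by gcongr; linarith
    rw [← ENNReal.ofReal_mul (Real.exp_pos _).le, ← Real.exp_add,
      show (16 : ENNReal) = ENNReal.ofReal 16 by simp, ← ENNReal.ofReal_pow (by norm_num)]
    refine ENNReal.ofReal_le_ofReal ((pow_le_pow_left₀ (by norm_num) he n).trans ?_)
    rw [← Real.exp_nat_mul, Real.exp_le_exp]
    have : (d : ℝ) ≤ n := by exact_mod_cast hdn
    linarith
  have hc0 : c ≠ 0 := mul_ne_zero (by simp [Real.exp_pos]) hV0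
  have hctop : c ≠ ⊤ := ENNReal.mul_ne_top ENNReal.ofReal_ne_top hVtop
  rw [← ENNReal.mul_le_mul_iff_right hc0 hctop]
  calc _ ≤ 16 ^ n * V := hmarkov
    _ ≤ (ENNReal.ofReal (Real.exp (4 * n)) * ENNReal.ofReal (Real.exp (-(d : ℝ)))) * V := by
      gcongr
    _ = _ := by rw [hc]; ring

theorem isOpNormConst (hd : 0 < d) (hdn : d ≤ n) : IsOpNormConst n d 256 := by
  have hd' : (0 : ℝ) < d := by exact_mod_cast hd
  refine ⟨by norm_num, ?_⟩
  set S := {Q : Matrix (Fin n) (Fin d) ℝ |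
    (1 / (d : ℝ)) * ‖Matrix.toEuclideanCLM (n := Fin n) (𝕜 := ℝ) (Q * Qᵀ)‖ ≤
      256 * (n / d)} with hS
  set B := {Q : Matrix (Fin n) (Fin d) ℝ | 256 * (n : ℝ) < ‖transposeCLM Q‖ ^ 2} with hB
  have hcover : (Set.univ : Set (Matrix (Fin n) (Fin d) ℝ)) ⊆ S ∪ B := by
    intro Q _
    by_cases hQ : Q ∈ B
    · exact Or.inr hQ
    · left
      simp only [hB, Set.mem_ofPred_eq, not_lt] at hQ
      simp only [hS, Set.mem_ofPred_eq]
      rw [one_div, ← div_eq_inv_mul, ← mul_div_assoc]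
      gcongr
      exact (norm_toEuclideanCLM_mul_transpose_le Q).trans hQ
  have h1 : (1 : ℝ) ≤ (gaussianMatrix n d).real S + (gaussianMatrix n d).real B := by
    rw [← probReal_univ (μ := gaussianMatrix n d)]
    exact (measureReal_mono hcover).trans (measureReal_union_le _ _)
  have h2 : (gaussianMatrix n d).real B ≤ Real.exp (-(d : ℝ)) :=
    ENNReal.toReal_le_of_le_ofReal (Real.exp_pos _).le
      (measure_operatorNorm_tail (hd.trans_le hdn) hdn)
  linarith [Real.exp_pos (-(d : ℝ))]

end OperatorNorm

/-! ### Probability of a good sample -/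

section GoodSampleProbability

variable {n d : ℕ}

theorem measurable_norm_toEuclideanCLM_mul_transpose :
    Measurable fun Q : Matrix (Fin n) (Fin d) ℝ =>
      ‖Matrix.toEuclideanCLM (n := Fin n) (𝕜 := ℝ) (Q * Qᵀ)‖ := by
  have h : Continuous fun A : Matrix (Fin n) (Fin n) ℝ =>
      Matrix.toEuclideanCLM (n := Fin n) (𝕜 := ℝ) A :=
    LinearMap.continuous_of_finiteDimensional
      (Matrix.toEuclideanCLM (n := Fin n) (𝕜 := ℝ)).toAlgEquiv.toLinearMap
  exact h.norm.measurable.comp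
    (measurable_matrix_mul measurable_id (measurable_matrix_transpose measurable_id))

theorem measurableSet_goodSample (C ε : ℝ) :
    MeasurableSet {p : EuclideanSpace ℝ (Fin n) × Matrix (Fin n) (Fin d) ℝ |
      GoodSample n d C ε p.1 p.2} := by
  have h : Measurable fun p : EuclideanSpace ℝ (Fin n) × Matrix (Fin n) (Fin d) ℝ =>
      WithLp.toLp 2 (p.2ᵀ *ᵥ p.1.ofLp) :=
    (WithLp.measurable_toLp 2 (Fin d → ℝ)).comp
      (measurable_matrix_mulVec (measurable_matrix_transpose measurable_snd)
        ((WithLp.measurable_ofLp 2 (Fin n → ℝ)).comp measurable_fst))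
  have hA := measurableSet_le
    (((measurable_fst (α := EuclideanSpace ℝ (Fin n))
      (β := Matrix (Fin n) (Fin d) ℝ)).norm.pow_const 2).const_mul (1 - ε))
    ((h.const_smul (1 / √(d : ℝ))).norm.pow_const 2)
  have hN : Measurable fun p : EuclideanSpace ℝ (Fin n) × Matrix (Fin n) (Fin d) ℝ =>
      (1 / (d : ℝ)) * ‖Matrix.toEuclideanCLM (n := Fin n) (𝕜 := ℝ) (p.2 * p.2ᵀ)‖ :=
    (measurable_norm_toEuclideanCLM_mul_transpose.comp measurable_snd).const_mul _
  have hB := measurableSet_le hN (measurable_const (a := C * ((n : ℝ) / d)))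
  exact hA.inter hB

theorem pEps_le_measureReal_goodSample {C₀ C ε : ℝ} (hC₀ : IsNormConcentrationConst n d C₀)
    (hC : IsOpNormConst n d C) (h0 : 0 < ε) (h1 : ε < 1) (v : EuclideanSpace ℝ (Fin n)) :
    pEps d C₀ ε ≤ (gaussianMatrix n d).real {Q | GoodSample n d C ε v Q} := by
  set γ := gaussianMatrix n d
  set A := {Q : Matrix (Fin n) (Fin d) ℝ |
    (1 - ε) * ‖v‖ ^ 2 ≤ ‖(1 / √(d : ℝ)) • WithLp.toLp 2 (Qᵀ *ᵥ v.ofLp)‖ ^ 2} with hA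
  set B := {Q : Matrix (Fin n) (Fin d) ℝ |
    (1 / (d : ℝ)) * ‖Matrix.toEuclideanCLM (n := Fin n) (𝕜 := ℝ) (Q * Qᵀ)‖ ≤ C * (n / d)} with hB
  have hBmeas : MeasurableSet B := measurableSet_le
    (measurable_norm_toEuclideanCLM_mul_transpose.const_mul _) measurable_const
  -- Inclusion–exclusion with `γ (A ∪ B) ≤ 1` gives `γ (A ∩ B) ≥ γ A + γ B - 1`.
  have hAB := measureReal_union_add_inter (μ := γ) (s := A) hBmeas
  have hle : γ.real (A ∪ B) ≤ 1 := measureReal_le_one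
  have hA1 : 1 - 2 * Real.exp (-(C₀ * ε ^ 2 * d)) ≤ γ.real A :=
    (hC₀.2 ε h0 h1 v).trans (measureReal_mono fun Q hQ => hQ.1)
  have hB1 : 1 - 2 * Real.exp (-(d : ℝ)) ≤ γ.real B := hC.2
  have hgood : {Q | GoodSample n d C ε v Q} = A ∩ B := rfl
  rw [hgood, pEps]
  linarith

end GoodSampleProbability

/-! ### Independence of the new sample from the past -/

/-- If every section of `G` has measure at least `p` under the law of `Q`, and `Q` is independent
of `X`, then restricting to the event `(X, Q) ∈ G` keeps the portion `p` of an expectation. -/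
theorem mul_integral_le_integral_indicator {Ω E F : Type*} [MeasurableSpace Ω]
    [MeasurableSpace E] [MeasurableSpace F] {μ : Measure Ω} [IsProbabilityMeasure μ]
    {γ : Measure F} [IsProbabilityMeasure γ] {X : Ω → E} {Q : Ω → F} (hX : AEMeasurable X μ)
    (hQ : HasLaw Q γ μ) (hXQ : IndepFun X Q μ) {D : E → ℝ} (hD : Measurable D)
    (hD0 : ∀ x, 0 ≤ D x) (hDX : Integrable (fun ω => D (X ω)) μ) {G : Set (E × F)}
    (hG : MeasurableSet G) {p : ℝ} (hp : ∀ x, p ≤ γ.real (Prod.mk x ⁻¹' G)) :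
    Integrable (fun ω => G.indicator (fun z => D z.1) (X ω, Q ω)) μ ∧
      p * ∫ ω, D (X ω) ∂μ ≤ ∫ ω, G.indicator (fun z => D z.1) (X ω, Q ω) ∂μ := by
  have hXQm : AEMeasurable (fun ω => (X ω, Q ω)) μ := hX.prodMk hQ.aemeasurable
  -- By independence the joint law is a product, so Fubini applies; the inner integral at `x` is `D
  -- x` times the measure of the section of `G`.
  have hmap : μ.map (fun ω => (X ω, Q ω)) = (μ.map X).prod γ := by
    rw [(indepFun_iff_map_prod_eq_prod_map_map hX hQ.aemeasurable).1 hXQ, hQ.map_eq]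
  have hmeas : Measurable (G.indicator fun z : E × F => D z.1) :=
    (hD.comp measurable_fst).indicator hG
  have : IsProbabilityMeasure (μ.map X) := Measure.isProbabilityMeasure_map hX
  have hDint : Integrable D (μ.map X) :=
    (integrable_map_measure hD.aestronglyMeasurable hX).2 hDX
  have hint : Integrable (G.indicator fun z : E × F => D z.1) ((μ.map X).prod γ) :=
    (hDint.comp_fst γ).indicator hG
  constructor
  · rw [← hmap] at hint
    exact (integrable_map_measure hmeas.aestronglyMeasurable hXQm).1 hint
  · rw [← integral_map (f := G.indicator fun z : E × F => D z.1) hXQm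
      hmeas.aestronglyMeasurable, hmap, integral_prod _ hint,
      ← integral_map (f := D) hX hD.aestronglyMeasurable, ← integral_const_mul]
    refine integral_mono (hDint.const_mul p) hint.integral_prod_left fun x => ?_
    have h : ∀ q, G.indicator (fun z : E × F => D z.1) (x, q) =
        (Prod.mk x ⁻¹' G).indicator (fun _ => D x) q := fun q => rfl
    simp_rw [h]
    rw [integral_indicator (measurable_prodMk_left hG), setIntegral_const, smul_eq_mul]
    exact mul_le_mul_of_nonneg_right (hp x) (hD0 x)

section Independence

variable {n d m : ℕ} {f : EuclideanSpace ℝ (Fin n) → ℝ} {β c M₁ M₂ : ℝ} {S₀ : State n m}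
  {Ω : Type*} [MeasurableSpace Ω] {μ : Measure Ω} {Q : ℕ → Ω → Matrix (Fin n) (Fin d) ℝ}

theorem aemeasurable_run_x (hf : Measurable f) (hg : Measurable (gradient f))
    (hQ : ∀ k, AEMeasurable (Q k) μ) (k : ℕ) :
    AEMeasurable (fun ω => (run f β c M₁ M₂ S₀ (fun j => Q j ω) k).x) μ :=
  (measurableState_run hf hg S₀ k).x.comp_aemeasurable (aemeasurable_pi_lambda _ hQ)

/-- The `k`-th point is a function of the samples with index below `k` only. The finite family is
padded with zeros by `e`, which by `run_congr` does not change that point. -/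
theorem indepFun_run_x (hf : Measurable f) (hg : Measurable (gradient f))
    (hQ : ∀ k, AEMeasurable (Q k) μ) (hind : iIndepFun Q μ) (k : ℕ) :
    IndepFun (fun ω => (run f β c M₁ M₂ S₀ (fun j => Q j ω) k).x) (Q k) μ := by
  have h := hind.indepFun_finset₀ (Finset.range k) {k} (by simp) hQ
  let e : (Finset.range k → Matrix (Fin n) (Fin d) ℝ) → ℕ → Matrix (Fin n) (Fin d) ℝ :=
    fun q j => if hj : j ∈ Finset.range k then q ⟨j, hj⟩ else 0
  have he : Measurable e := by
    refine measurable_pi_lambda _ fun j => ?_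
    by_cases hj : j ∈ Finset.range k
    · simpa only [e, hj, dite_true] using measurable_pi_apply _
    · simp only [e, hj, dite_false]
      exact measurable_const
  have h2 := h.comp ((measurableState_run (β := β) (c := c) (M₁ := M₁) (M₂ := M₂)
    hf hg S₀ k).x.comp he) (measurable_pi_apply ⟨k, Finset.mem_singleton_self k⟩)
  convert h2 using 1
  · funext ω
    simp only [Function.comp_apply]
    rw [run_congr S₀ fun j hj => ?_]
    simp [e, hj]
  · rfl

end Independence

/-! ### Contraction of the expected gap -/

section Convergence

variable {n d m : ℕ} {f : EuclideanSpace ℝ (Fin n) → ℝ} {L σ fstar β c M₁ M₂ : ℝ}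

/-- One iteration decreases the objective gap by a fixed portion when the sample is good. -/
theorem step_gap_le_of_goodSample (hn : 0 < n) (hd : 0 < d) (hm : 2 ≤ m) {C ε : ℝ} (hC : 0 < C)
    (hε : ε < 1) (hf : Differentiable ℝ f) (hL0 : 0 < L)
    (hL : ∀ u v, ‖gradient f u - gradient f v‖ ≤ L * ‖u - v‖)
    (hPL : ∀ x, 2 * σ * (f x - fstar) ≤ ‖gradient f x‖ ^ 2)
    (hM₁ : 0 < M₁) (hM₂ : 0 < M₂) (hβ0 : 0 < β) (hβ1 : β < 1) (hc0 : 0 < c) (hc1 : c < 1)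
    {S : State n m} (hS : S.Valid M₁ M₂) {Q : Matrix (Fin n) (Fin d) ℝ}
    (hQ : GoodSample n d C ε (gradient f S.x) Q) :
    f (step f β c M₁ M₂ Q S).x - fstar ≤ (f S.x - fstar) -
      2 * σ * c * alphaBar m β c M₂ L * M₁ * ((1 - ε) * d / (C * n)) ^ 2 * (f S.x - fstar) := by
  have h1 := step_decrease hf hL0 hL (by omega) hM₁ hM₂ hβ0 hβ1 hc0 hc1 hS Q
  have h2 := hQ.le_projected_gradient hn hd hC hε hm S.P
  have h3 := mul_le_mul_of_nonneg_left (hPL S.x) (sq_nonneg ((1 - ε) * d / (C * n)))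
  have hα := alphaBar_pos (m := m) hL0 (by omega) hM₂ hβ0 hc1
  have h4 := mul_le_mul_of_nonneg_left (h3.trans h2)
    (by positivity : 0 ≤ c * alphaBar m β c M₂ L * M₁)
  linarith

/-- The iteration `E (k + 1) ≤ ρ * E k` of nonnegative numbers gives `E k ≤ ρ ^ k * E 0`, also for
negative `ρ`. -/
theorem le_pow_mul_of_succ_le {E : ℕ → ℝ} {ρ : ℝ} (h0 : ∀ k, 0 ≤ E k)
    (hmono : ∀ k, E (k + 1) ≤ E k) (hρ : ∀ k, E (k + 1) ≤ ρ * E k) (k : ℕ) :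
    E k ≤ ρ ^ k * E 0 := by
  rcases (h0 0).eq_or_lt with h | h
  · have := antitone_nat_of_succ_le hmono (Nat.zero_le k)
    rw [← h] at this ⊢
    simpa using this
  · have hρ0 : 0 ≤ ρ := nonneg_of_mul_nonneg_left ((h0 1).trans (hρ 0)) h
    induction k with
    | zero => simp
    | succ k ih =>
      calc E (k + 1) ≤ ρ * E k := hρ k
        _ ≤ ρ * (ρ ^ k * E 0) := mul_le_mul_of_nonneg_left ih hρ0
        _ = ρ ^ (k + 1) * E 0 := by ring

theorem tendsto_zero_of_succ_le {E : ℕ → ℝ} {ρ : ℝ} (h0 : ∀ k, 0 ≤ E k)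
    (hmono : ∀ k, E (k + 1) ≤ E k) (hρ : ∀ k, E (k + 1) ≤ ρ * E k) (hρ1 : ρ < 1) :
    Tendsto E atTop (𝓝 0) := by
  have hle := le_pow_mul_of_succ_le h0 hmono hρ
  refine squeeze_zero h0 (g := fun k => max ρ 0 ^ k * E 0) (fun k => ?_) ?_
  · rcases le_or_gt 0 ρ with h | h
    · rw [max_eq_left h]
      exact hle k
    · have h1 : E 0 = 0 := le_antisymm (by nlinarith [h0 0, h0 1, hρ 0]) (h0 0)
      have := hle k
      rw [h1, mul_zero] at this ⊢
      exact this
  · have h := (tendsto_pow_atTop_nhds_zero_of_lt_one (le_max_right ρ 0)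
      (max_lt hρ1 zero_lt_one)).mul_const (E 0)
    rwa [zero_mul] at h

theorem rate_lt_one (hn : 0 < n) (hd : 0 < d) (hm : 0 < m) {C₀ C ε : ℝ} (hC : 0 < C)
    (hε : ε < 1) (hL0 : 0 < L) (hσ : 0 < σ) (hM₁ : 0 < M₁) (hM₂ : 0 < M₂) (hβ0 : 0 < β)
    (hc0 : 0 < c) (hc1 : c < 1) (hp : 0 < pEps d C₀ ε) :
    rate n d m β c M₁ M₂ L σ C₀ C ε < 1 := by
  have hα := alphaBar_pos (m := m) hL0 hm hM₂ hβ0 hc1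
  have hd' : (0 : ℝ) < d := by exact_mod_cast hd
  have hn' : (0 : ℝ) < n := by exact_mod_cast hn
  have hε' : 0 < 1 - ε := by linarith
  rw [rate, sub_lt_self_iff]
  positivity

variable {S₀ : State n m} {Ω : Type*} [MeasurableSpace Ω] {μ : Measure Ω}
  [IsProbabilityMeasure μ] {Q : ℕ → Ω → Matrix (Fin n) (Fin d) ℝ}

/-- Along every sample path the gap lies between `0` and its initial value, so it is bounded. -/
theorem integrable_gap_run (hf : Differentiable ℝ f) (hL0 : 0 < L)
    (hL : ∀ u v, ‖gradient f u - gradient f v‖ ≤ L * ‖u - v‖) (hm : 0 < m)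
    (hfstar : ∀ x, fstar ≤ f x) (hM₁ : 0 < M₁) (hM₂ : 0 < M₂) (hβ0 : 0 < β) (hβ1 : β < 1)
    (hc0 : 0 < c) (hc1 : c < 1) (hS₀ : S₀.Valid M₁ M₂) (hQ : ∀ k, AEMeasurable (Q k) μ) (k : ℕ) :
    Integrable (fun ω => f (run f β c M₁ M₂ S₀ (fun j => Q j ω) k).x - fstar) μ := by
  have hx := aemeasurable_run_x (β := β) (c := c) (M₁ := M₁) (M₂ := M₂) (S₀ := S₀)
    hf.continuous.measurable (continuous_gradient_of_lipschitz hL).measurable hQ k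
  refine Integrable.of_bound ((hf.continuous.measurable.comp_aemeasurable hx).sub_const
    fstar).aestronglyMeasurable (f S₀.x - fstar) (Eventually.of_forall fun ω => ?_)
  have hmono : Antitone fun k => f (run f β c M₁ M₂ S₀ (fun j => Q j ω) k).x :=
    antitone_nat_of_succ_le fun k =>
      step_le hf hL0 hL hm hM₁ hM₂ hβ0 hβ1 hc0 hc1 (hS₀.run hm _ k) _
  rw [Real.norm_of_nonneg (sub_nonneg.2 (hfstar _))]
  exact sub_le_sub_right (hmono (Nat.zero_le k)) _

/-- Pathwise, the gap loses the portion `κ` on the good event and does not increase off it. Taking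
expectations, independence bounds the mean loss below by `κ p(ε)` times the mean gap. -/
theorem integral_gap_run_succ_le (hn : 0 < n) (hd : 0 < d) (hm : 2 ≤ m) {C₀ C ε : ℝ}
    (hC₀ : IsNormConcentrationConst n d C₀) (hC : IsOpNormConst n d C) (hε0 : 0 < ε)
    (hε1 : ε < 1) (hf : Differentiable ℝ f) (hL0 : 0 < L)
    (hL : ∀ u v, ‖gradient f u - gradient f v‖ ≤ L * ‖u - v‖)
    (hfstar : ∀ x, fstar ≤ f x) (hσ : 0 < σ)
    (hPL : ∀ x, 2 * σ * (f x - fstar) ≤ ‖gradient f x‖ ^ 2)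
    (hM₁ : 0 < M₁) (hM₂ : 0 < M₂) (hβ0 : 0 < β) (hβ1 : β < 1) (hc0 : 0 < c) (hc1 : c < 1)
    (hS₀ : S₀.Valid M₁ M₂) (hQ : ∀ k, HasLaw (Q k) (gaussianMatrix n d) μ)
    (hind : iIndepFun Q μ) (k : ℕ) :
    ∫ ω, (f (run f β c M₁ M₂ S₀ (fun j => Q j ω) (k + 1)).x - fstar) ∂μ ≤
      rate n d m β c M₁ M₂ L σ C₀ C ε *
        ∫ ω, (f (run f β c M₁ M₂ S₀ (fun j => Q j ω) k).x - fstar) ∂μ := by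
  have hm0 : 0 < m := by omega
  have hfm := hf.continuous.measurable
  have hgm := (continuous_gradient_of_lipschitz hL).measurable
  have hQm : ∀ k, AEMeasurable (Q k) μ := fun k => (hQ k).aemeasurable
  have hint := integrable_gap_run (n := n) (S₀ := S₀) hf hL0 hL hm0 hfstar hM₁ hM₂ hβ0 hβ1 hc0
    hc1 hS₀ hQm
  set κ := 2 * σ * c * alphaBar m β c M₂ L * M₁ * ((1 - ε) * d / (C * n)) ^ 2 with hκ
  have hκ0 : 0 ≤ κ := by
    have := alphaBar_pos (m := m) hL0 hm0 hM₂ hβ0 hc1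
    positivity
  set G := {p : EuclideanSpace ℝ (Fin n) × Matrix (Fin n) (Fin d) ℝ |
    GoodSample n d C ε (gradient f p.1) p.2} with hG
  have hpair : Measurable fun p : EuclideanSpace ℝ (Fin n) × Matrix (Fin n) (Fin d) ℝ =>
      (gradient f p.1, p.2) := (hgm.comp measurable_fst).prodMk measurable_snd
  have hGm : MeasurableSet G := hpair (measurableSet_goodSample C ε)
  obtain ⟨h1, h2⟩ := mul_integral_le_integral_indicator
    (aemeasurable_run_x (S₀ := S₀) hfm hgm hQm k) (hQ k)
    (indepFun_run_x (β := β) (c := c) (M₁ := M₁) (M₂ := M₂) hfm hgm hQm hind k)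
    (D := fun x => f x - fstar) (hfm.sub_const _) (fun x => sub_nonneg.2 (hfstar x)) (hint k)
    hGm (fun x => pEps_le_measureReal_goodSample hC₀ hC hε0 hε1 (gradient f x))
  set X := fun ω => (run f β c M₁ M₂ S₀ (fun j => Q j ω) k).x with hX
  have hpt : ∀ ω, f (run f β c M₁ M₂ S₀ (fun j => Q j ω) (k + 1)).x - fstar ≤
      (f (X ω) - fstar) - κ * G.indicator (fun z => f z.1 - fstar) (X ω, Q k ω) := by
    intro ω
    have hv := hS₀.run (f := f) (β := β) (c := c) hm0 (fun j => Q j ω) k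
    by_cases hω : (X ω, Q k ω) ∈ G
    · rw [Set.indicator_of_mem hω]
      exact step_gap_le_of_goodSample hn hd hm hC.1 hε1 hf hL0 hL hPL hM₁ hM₂ hβ0 hβ1 hc0 hc1
        hv hω
    · rw [Set.indicator_of_notMem hω, mul_zero, sub_zero]
      exact sub_le_sub_right (step_le hf hL0 hL hm0 hM₁ hM₂ hβ0 hβ1 hc0 hc1 hv _) _
  calc _ ≤ ∫ ω, ((f (X ω) - fstar) -
        κ * G.indicator (fun z => f z.1 - fstar) (X ω, Q k ω)) ∂μ :=
        integral_mono (hint (k + 1)) ((hint k).sub (h1.const_mul κ)) hpt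
    _ = ∫ ω, (f (X ω) - fstar) ∂μ -
        κ * ∫ ω, G.indicator (fun z => f z.1 - fstar) (X ω, Q k ω) ∂μ := by
        rw [integral_sub (hint k) (h1.const_mul κ), integral_const_mul]
    _ ≤ ∫ ω, (f (X ω) - fstar) ∂μ - κ * (pEps d C₀ ε * ∫ ω, (f (X ω) - fstar) ∂μ) :=
        sub_le_sub_left (mul_le_mul_of_nonneg_left h2 hκ0) _
    _ = _ := by
        rw [rate, hκ]
        ring

end Convergence

end SubspaceQN

/-! ### The main theorem -/

theorem theorem4 :
    -- Absolute constants as in the two random matrix estimates exist,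
    (∃ C₀ C : ℝ, ∀ n d : ℕ, 0 < d → d ≤ n →
      SubspaceQN.IsNormConcentrationConst n d C₀ ∧ SubspaceQN.IsOpNormConst n d C) ∧
    -- and for all such constants the algorithm converges at the claimed rate.
    ∀ (n d m : ℕ), 0 < n → 0 < d → 0 < m → Even m →
    ∀ (C₀ C : ℝ), SubspaceQN.IsNormConcentrationConst n d C₀ → SubspaceQN.IsOpNormConst n d C →
    ∀ (f : EuclideanSpace ℝ (Fin n) → ℝ) (L σ fstar : ℝ),
      Differentiable ℝ f → 0 < L → (∀ u v, ‖gradient f u - gradient f v‖ ≤ L * ‖u - v‖) →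
      IsGLB (Set.range f) fstar →
      0 < σ → (∀ x, 2 * σ * (f x - fstar) ≤ ‖gradient f x‖ ^ 2) →
    ∀ (β c M₁ M₂ : ℝ), 0 < β → β < 1 → 0 < c → c < 1 → 0 < M₁ → 0 < M₂ →
    ∀ (x₀ : EuclideanSpace ℝ (Fin n)) (P₀ : Matrix (Fin n) (Fin m) ℝ)
      (H₀ : Matrix (Fin m) (Fin m) ℝ),
      (∀ j, ‖WithLp.toLp 2 (fun i => P₀ i j)‖ ≤ 1) →
      (H₀ - M₁ • (1 : Matrix (Fin m) (Fin m) ℝ)).PosSemidef →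
      (M₂ • (1 : Matrix (Fin m) (Fin m) ℝ) - H₀).PosSemidef →
    ∀ {Ω : Type*} [MeasurableSpace Ω] (μ : Measure Ω) [IsProbabilityMeasure μ]
      (Q : ℕ → Ω → Matrix (Fin n) (Fin d) ℝ),
      (∀ k, HasLaw (Q k) (SubspaceQN.gaussianMatrix n d) μ) → iIndepFun Q μ →
    let X : ℕ → Ω → EuclideanSpace ℝ (Fin n) := fun k ω =>
      (SubspaceQN.run f β c M₁ M₂ ⟨x₀, P₀, H₀⟩ (fun j => Q j ω) k).x
    ∀ ε : ℝ, 0 < ε → ε < 1 →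
      let ρ : ℝ := SubspaceQN.rate n d m β c M₁ M₂ L σ C₀ C ε
      (∀ k : ℕ, Integrable (fun ω => f (X k ω) - fstar) μ ∧
        ∫ ω, (f (X k ω) - fstar) ∂μ ≤ ρ ^ k * (f x₀ - fstar)) ∧
      (0 < SubspaceQN.pEps d C₀ ε →
        ρ < 1 ∧ Tendsto (fun k => ∫ ω, (f (X k ω) - fstar) ∂μ) atTop (𝓝 0)) := by
  refine ⟨⟨1 / 16, 256, fun n d hd hdn => ⟨SubspaceQN.isNormConcentrationConst hd,
    SubspaceQN.isOpNormConst hd hdn⟩⟩, ?_⟩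
  intro n d m hn hd hm hme C₀ C hC₀ hC f L σ fstar hf hL0 hL hfstar hσ hPL β c M₁ M₂ hβ0 hβ1
    hc0 hc1 hM₁ hM₂ x₀ P₀ H₀ hP₀ hH₁ hH₂ Ω _ μ _ Q hQ hind X ε hε0 hε1 ρ
  have hm2 : 2 ≤ m := by
    obtain ⟨r, hr⟩ := hme
    omega
  have hlow : ∀ x, fstar ≤ f x := fun x => hfstar.1 ⟨x, rfl⟩
  have hS₀ : (⟨x₀, P₀, H₀⟩ : SubspaceQN.State n m).Valid M₁ M₂ := ⟨hP₀, hH₁, hH₂⟩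
  have hint : ∀ k, Integrable (fun ω => f (X k ω) - fstar) μ :=
    SubspaceQN.integrable_gap_run hf hL0 hL hm hlow hM₁ hM₂ hβ0 hβ1 hc0 hc1 hS₀
      fun k => (hQ k).aemeasurable
  have h0 : ∀ k, 0 ≤ ∫ ω, (f (X k ω) - fstar) ∂μ := fun k =>
    integral_nonneg fun ω => sub_nonneg.2 (hlow _)
  have hmono : ∀ k, ∫ ω, (f (X (k + 1) ω) - fstar) ∂μ ≤ ∫ ω, (f (X k ω) - fstar) ∂μ :=
    fun k => integral_mono (hint (k + 1)) (hint k) fun ω => sub_le_sub_right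
      (SubspaceQN.step_le hf hL0 hL hm hM₁ hM₂ hβ0 hβ1 hc0 hc1 (hS₀.run hm _ k) _) _
  have hsucc : ∀ k, ∫ ω, (f (X (k + 1) ω) - fstar) ∂μ ≤ ρ * ∫ ω, (f (X k ω) - fstar) ∂μ :=
    SubspaceQN.integral_gap_run_succ_le hn hd hm2 hC₀ hC hε0 hε1 hf hL0 hL hlow hσ hPL hM₁ hM₂
      hβ0 hβ1 hc0 hc1 hS₀ hQ hind
  have hE0 : ∫ ω, (f (X 0 ω) - fstar) ∂μ = f x₀ - fstar := by
    simp [X, SubspaceQN.run]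
  refine ⟨fun k => ⟨hint k, ?_⟩, fun hp => ?_⟩
  · rw [← hE0]
    exact SubspaceQN.le_pow_mul_of_succ_le h0 hmono hsucc k
  · have hρ1 : ρ < 1 := SubspaceQN.rate_lt_one hn hd hm hC.1 hε1 hL0 hσ hM₁ hM₂ hβ0 hc0 hc1 hp
    exact ⟨hρ1, SubspaceQN.tendsto_zero_of_succ_le h0 hmono hsucc hρ1⟩
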